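/- Let $n\ge 2$ be an integer and let $1\le p\le n$ and $s\ge 1$ be real numbers. There exist an $s$-John domain $\Omega\subset\mathbb{R}^n$ with John center $x_0$ and a sequence $(E_j)$ of compact subsets of $\Omega$ such that, for every Whitney decomposition of $\Omega$ and every cube $Q_0$ of it that contains $x_0$ (a central Whitney cube): (i) each $E_j$ is disjoint from $Q_0$; (ii) for every real $q$ with $0<q<\min\{(n-1)s+1-p,\,n\}$ there is a constant $c>0$ with $\mathcal H^q_\infty(E_j)\ge c$ for all $j$, and $\operatorname{cap}_p(E_j,Q_0,\Omega)\to 0$ as $j\to\infty$. Here an $s$-John domain with John center $x_0\in\Omega$ is a bounded, open, connected set $\Omega$ for which there is a constant $C>0$ such that each $x\in\Omega$ can be joined to $x_0$ by a rectifiable curve $\gamma:[0,1]\to\Omega$, $\gamma(0)=x$, $\gamma(1)=x_0$, with $\ell(\gamma|_{[0,t]})^s\le C\,d(\gamma(t),\partial\Omega)$ for all $0<t\le1$. A Whitney decomposition of $\Omega$ is a family of closed cubes with edges parallel to the axes, pairwise disjoint interiors and union $\Omega$, whose diameters are integer powers of $2$ and satisfy $\operatorname{diam}Q\le \operatorname{dist}(Q,\partial\Omega)\le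 4\operatorname{diam}Q$. The Hausdorff content $\mathcal H^q_\infty(E)$ is the infimum of $\sum_i r_i^q$ over all countable coverings of $E$ by balls $B(x_i,r_i)$. Finally, $\operatorname{cap}_p(E,Q_0,\Omega)$ is the infimum of $\int_\Omega|\nabla u|^p\,dx$ over all continuous $u\in W^{1,p}_{\mathrm{loc}}(\Omega)$ with $u\le 0$ on $E$ and $u\ge1$ on $Q_0$. -/

import Mathlib

open scoped ENNReal NNReal ContDiff Topology

noncomputable section

namespace SJohn

/-- `Ω` is an `s`-John domain with John center `x₀`: a bounded domain such that, for some constant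
`C`, every `x ∈ Ω` can be joined to `x₀` by a rectifiable curve `γ : [0,1] → Ω` with
`l(γ([0,t]))^s ≤ C d(γ(t), ∂Ω)` for `0 < t ≤ 1`.
The length of `γ` on `[0,t]` is its total variation there. -/
structure IsSJohnDomain {n : ℕ} (s : ℝ) (Ω : Set (EuclideanSpace ℝ (Fin n)))
    (x₀ : EuclideanSpace ℝ (Fin n)) : Prop where
  isOpen : IsOpen Ω
  isConnected : IsConnected Ω
  isBounded : Bornology.IsBounded Ω
  center_mem : x₀ ∈ Ω
  exists_curve : ∃ C : ℝ, 0 < C ∧ ∀ x ∈ Ω, ∃ γ : ℝ → EuclideanSpace ℝ (Fin n),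
    ContinuousOn γ (Set.Icc 0 1) ∧ Set.MapsTo γ (Set.Icc 0 1) Ω ∧ γ 0 = x ∧ γ 1 = x₀ ∧
    eVariationOn γ (Set.Icc 0 1) ≠ ⊤ ∧
    ∀ t ∈ Set.Ioc (0 : ℝ) 1,
      (eVariationOn γ (Set.Icc 0 t)).toReal ^ s ≤ C * Metric.infDist (γ t) (frontier Ω)

/-- The closed cube with lowest corner `a`, edge length `l` and edges parallel to the axes. -/
def closedCube {n : ℕ} (a : EuclideanSpace ℝ (Fin n)) (l : ℝ) :
    Set (EuclideanSpace ℝ (Fin n)) :=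
  {x | ∀ i, x i ∈ Set.Icc (a i) (a i + l)}

/-- The Euclidean distance between two (nonempty) sets. -/
def setDist {n : ℕ} (A B : Set (EuclideanSpace ℝ (Fin n))) : ℝ :=
  sInf {d : ℝ | ∃ x ∈ A, ∃ y ∈ B, d = dist x y}

/-- `W` is a Whitney decomposition of `Ω`. -/
structure IsWhitneyDecomposition {n : ℕ} (Ω : Set (EuclideanSpace ℝ (Fin n)))
    (W : Set (Set (EuclideanSpace ℝ (Fin n)))) : Prop where
  isCube : ∀ Q ∈ W, ∃ (a : EuclideanSpace ℝ (Fin n)) (l : ℝ), 0 < l ∧ Q = closedCube a l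
  sUnion_eq : ⋃₀ W = Ω
  disjoint_interior : ∀ Q ∈ W, ∀ Q' ∈ W, Q ≠ Q' → Disjoint (interior Q) (interior Q')
  diam_eq : ∀ Q ∈ W, ∃ j : ℤ, Metric.diam Q = (2 : ℝ) ^ (-j)
  diam_le_dist : ∀ Q ∈ W, Metric.diam Q ≤ setDist Q (frontier Ω)
  dist_le : ∀ Q ∈ W, setDist Q (frontier Ω) ≤ 4 * Metric.diam Q

/-- The Hausdorff `q`-content (for `q > 0`): the infimum of `∑ r_i ^ q` over all coverings by
countably many balls `B(x_i, r_i)`. Radius zero gives the empty ball and contributes nothing, so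
finite coverings are included. -/
def hausdorffContent {n : ℕ} (q : ℝ) (A : Set (EuclideanSpace ℝ (Fin n))) : ℝ≥0∞ :=
  ⨅ (x : ℕ → EuclideanSpace ℝ (Fin n)) (r : ℕ → ℝ≥0)
    (_ : A ⊆ ⋃ i, Metric.ball (x i) (r i)), ∑' i, (r i : ℝ≥0∞) ^ q

/-- `f ∈ L^p_loc(Ω)`: `f ∈ L^p(K)` for every compact `K ⊆ Ω`. -/
def MemLpLoc {n : ℕ} {F : Type*} [NormedAddCommGroup F] (p : ℝ)
    (Ω : Set (EuclideanSpace ℝ (Fin n))) (f : EuclideanSpace ℝ (Fin n) → F) : Prop :=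
  ∀ K ⊆ Ω, IsCompact K → MeasureTheory.MemLp f (ENNReal.ofReal p)
    (MeasureTheory.volume.restrict K)

/-- `u ∈ W^{1,p}_loc(Ω)` with weak gradient `g`: both are in `L^p_loc(Ω)`, and
`∫_Ω u ∂_v φ = - ∫_Ω ⟨g, v⟩ φ` for all `φ ∈ C_c^∞(Ω)` and all directions `v`. -/
structure MemW1pLoc {n : ℕ} (p : ℝ) (Ω : Set (EuclideanSpace ℝ (Fin n)))
    (u : EuclideanSpace ℝ (Fin n) → ℝ)
    (g : EuclideanSpace ℝ (Fin n) → EuclideanSpace ℝ (Fin n)) : Prop where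
  memLpLoc : MemLpLoc p Ω u
  memLpLoc_grad : MemLpLoc p Ω g
  integral_eq : ∀ φ : EuclideanSpace ℝ (Fin n) → ℝ, ContDiff ℝ ∞ φ → HasCompactSupport φ →
    tsupport φ ⊆ Ω → ∀ v : EuclideanSpace ℝ (Fin n),
      ∫ x in Ω, u x * fderiv ℝ φ x v = - ∫ x in Ω, inner ℝ (g x) v * φ x

/-- The `p`-capacity `cap_p(E, F, Ω)`: the infimum of `∫_Ω |∇u|^p` over all continuous
`u ∈ W^{1,p}_loc(Ω)` with `u ≤ 0` on `E` and `u ≥ 1` on `F`. -/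
def capacity {n : ℕ} (p : ℝ) (E F Ω : Set (EuclideanSpace ℝ (Fin n))) : ℝ≥0∞ :=
  ⨅ (u : EuclideanSpace ℝ (Fin n) → ℝ)
    (g : EuclideanSpace ℝ (Fin n) → EuclideanSpace ℝ (Fin n))
    (_ : ContinuousOn u Ω ∧ MemW1pLoc p Ω u g ∧ (∀ x ∈ E, u x ≤ 0) ∧ (∀ x ∈ F, 1 ≤ u x)),
    ∫⁻ x in Ω, ‖g x‖ₑ ^ p

end SJohn

end

/-! ### Cantor construction on the line and its separation estimates -/

noncomputable section

namespace SJohn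

/-! The domain is a tree of rooms and corridors along an `n`-fold product of a Cantor construction.
A cell of level `k` is a cube of half-width `A k` around its node and contains `2 ^ n` cells of
level `k + 1`. The room at the node spans the cell, except in direction `i₀`, where its half-width
is only `g k`; so it stays `g k` away from the cells of level `k + 1`. These are reached only
through corridors of half-width `κ * A (k + 1) ^ s`, up to constants the least that an `s`-John
domain can afford. Climbing from node to parent, the lengths telescope to `2 * n * A k` at level
`k`, which `ratio` compares with the corridor width (`isJohnJoined_node`).

The function `min 1 (dist (·, cells of level k + 1) / g k)` varies only in the corridors of level
`k` (`mem_cell_or_far`), so its energy is at most a constant times `2 ^ (n k) * A k ^ ((n - 1) s +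
1) * g k ^ (-p)` (`capacity_le`). The compact sets are the unions of cubes of edge `g k` around the
nodes of one level; spreading mass uniformly over them bounds their `q`-content from below as soon
as `2 ^ (n k) * g k ^ q` is bounded below (`le_hausdorffContent_cores`).

It remains to choose the scales (`exists_isTreeScale`). Let `D` be the minimum in the theorem, `l =
2 ^ (-n / D)` and `A k = l ^ k / (k + 1) ^ M`, with `g k` at least `A k` divided by a multiple of `k
+ 2`. Then `2 ^ (n k) * A k ^ D = (k + 1) ^ (-M D)`. The polynomial factors are harmless for the
content when `q < D`, while `M D > p` makes the energy tend to zero although `D` may be the critical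
exponent itself. Hence one domain and one sequence serve all `q < D`. -/

/-- The half-widths `A k` and gaps `g k` of the cells of a binary Cantor construction whose gaps
are at least `κ * A k ^ s`. -/
structure IsTreeScale (s κ L : ℝ) (A g : ℕ → ℝ) : Prop where
  A_pos : ∀ k, 0 < A k
  g_pos : ∀ k, 0 < g k
  g_anti : Antitone g
  gap : ∀ k, 2 * g k ≤ A k - 2 * A (k + 1)
  κ_pos : 0 < κ
  width : ∀ k, κ * A k ^ s ≤ g k
  ratio : ∀ k, A k ≤ L * A (k + 1)

/-- The sign `±1` given by a Boolean. -/
def boolSign (b : Bool) : ℝ := if b then 1 else -1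

/-- The centre of the interval of level `k` with address `a` in the Cantor construction. -/
def node (A : ℕ → ℝ) (a : ℕ → Bool) (k : ℕ) : ℝ :=
  ∑ j ∈ Finset.range k, (A j - A (j + 1)) * boolSign (a j)

theorem abs_boolSign (b : Bool) : |boolSign b| = 1 := by
  cases b <;> simp [boolSign]

theorem node_succ (A : ℕ → ℝ) (a : ℕ → Bool) (k : ℕ) :
    node A a (k + 1) = node A a k + (A k - A (k + 1)) * boolSign (a k) := by
  simp [node, Finset.sum_range_succ]

@[simp] theorem node_zero (A : ℕ → ℝ) (a : ℕ → Bool) : node A a 0 = 0 := by simp [node]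

theorem node_congr (A : ℕ → ℝ) {a b : ℕ → Bool} {k : ℕ} (h : ∀ j < k, a j = b j) :
    node A a k = node A b k :=
  Finset.sum_congr rfl fun j hj => by rw [h j (Finset.mem_range.1 hj)]

namespace IsTreeScale

variable {s κ L : ℝ} {A g : ℕ → ℝ}

theorem two_mul_A_succ_le (h : IsTreeScale s κ L A g) (k : ℕ) : 2 * A (k + 1) ≤ A k := by
  linarith [h.gap k, h.g_pos k]

theorem A_succ_le (h : IsTreeScale s κ L A g) (k : ℕ) : A (k + 1) ≤ A k := by
  linarith [h.two_mul_A_succ_le k, h.A_pos (k + 1)]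

theorem A_anti (h : IsTreeScale s κ L A g) : Antitone A := antitone_nat_of_succ_le h.A_succ_le

theorem two_mul_g_le (h : IsTreeScale s κ L A g) (k : ℕ) : 2 * g k ≤ A k := by
  linarith [h.gap k, h.A_pos (k + 1)]

theorem g_le (h : IsTreeScale s κ L A g) (k : ℕ) : g k ≤ A k := by
  linarith [h.two_mul_g_le k, h.g_pos k]

theorem width_pos (h : IsTreeScale s κ L A g) (k : ℕ) : 0 < κ * A k ^ s :=
  mul_pos h.κ_pos (Real.rpow_pos_of_pos (h.A_pos k) s)

theorem width_le (h : IsTreeScale s κ L A g) (k : ℕ) : κ * A k ^ s ≤ A k :=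
  (h.width k).trans (h.g_le k)

theorem abs_node_succ_sub (h : IsTreeScale s κ L A g) (a : ℕ → Bool) (k : ℕ) :
    |node A a (k + 1) - node A a k| = A k - A (k + 1) := by
  rw [node_succ, add_sub_cancel_left, abs_mul, abs_boolSign, mul_one,
    abs_of_nonneg (sub_nonneg.2 (h.A_succ_le k))]

theorem abs_node_sub_le (h : IsTreeScale s κ L A g) (a : ℕ → Bool) {k l : ℕ} (hkl : k ≤ l) :
    |node A a l - node A a k| ≤ A k - A l := by
  induction l, hkl using Nat.le_induction with
  | base => simp
  | succ l hl ih =>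
    have := h.abs_node_succ_sub a l
    have h2 := abs_sub_le (node A a (l + 1)) (node A a l) (node A a k)
    linarith

theorem interval_mono (h : IsTreeScale s κ L A g) (a : ℕ → Bool) {k l : ℕ} (hkl : k ≤ l) {y : ℝ}
    (hy : |y - node A a l| ≤ A l) : |y - node A a k| ≤ A k := by
  have := h.abs_node_sub_le a hkl
  have h2 := abs_sub_le y (node A a l) (node A a k)
  linarith

/-- The two centres lie on opposite sides of a common parent, `2 * (A m - A (m + 1))` apart;
subtracting the two half-widths leaves `2 * (A m - 2 * A (m + 1))`, which `gap` bounds below. -/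
theorem sep_of_first_ne (h : IsTreeScale s κ L A g) {a b : ℕ → Bool} {m : ℕ}
    (hlt : ∀ j < m, a j = b j) (hne : a m ≠ b m) {y z : ℝ}
    (hy : |y - node A a (m + 1)| ≤ A (m + 1)) (hz : |z - node A b (m + 1)| ≤ A (m + 1)) :
    4 * g m ≤ |y - z| := by
  have hg := h.gap m
  have hA := h.A_succ_le m
  rw [node_succ, abs_le] at hy hz
  rw [← node_congr A hlt] at hz
  cases ha : a m <;> cases hb : b m <;> simp [ha, hb, boolSign] at hne hy hz
  · rw [abs_sub_comm]; exact le_trans (by linarith) (le_abs_self _)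
  · exact le_trans (by linarith) (le_abs_self _)

theorem sep_of_ne (h : IsTreeScale s κ L A g) {a b : ℕ → Bool} {m k : ℕ} (hmk : m < k)
    (hne : ∃ j ≤ m, a j ≠ b j) {y z : ℝ}
    (hy : |y - node A a k| ≤ A k) (hz : |z - node A b k| ≤ A k) :
    4 * g m ≤ |y - z| := by
  classical
  have hex : ∃ j, a j ≠ b j := hne.imp fun _ h => h.2
  have hfm : Nat.find hex ≤ m := by
    obtain ⟨j, hj, hj'⟩ := hne
    exact (Nat.find_min' hex hj').trans hj
  have := h.sep_of_first_ne (fun j hj => not_not.1 (Nat.find_min hex hj)) (Nat.find_spec hex)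
    (h.interval_mono a (by omega) hy) (h.interval_mono b (by omega) hz)
  linarith [h.g_anti hfm]

/-- The centres of level `j` are far from the cells of every level `k > j`. -/
theorem sep_node (h : IsTreeScale s κ L A g) (a b : ℕ → Bool) {j k : ℕ} (hjk : j < k) {y : ℝ}
    (hy : |y - node A b k| ≤ A k) : 2 * g j ≤ |y - node A a j| := by
  by_cases hne : ∃ i < j, b i ≠ a i
  · obtain ⟨i, hi, hne⟩ := hne
    -- Here `i < j` forces `j ≥ 1`, so `j - 1` is a true predecessor, and `y` and the node lie in
    -- different intervals of level `j`.
    have h1 := h.sep_of_ne (m := j - 1) (k := j) (y := y) (z := node A a j) (by omega)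
      ⟨i, by omega, hne⟩ (h.interval_mono b hjk.le hy) (by simpa using (h.A_pos j).le)
    linarith [h.g_anti (Nat.sub_le j 1), h.g_pos j]
  · push Not at hne
    rw [← node_congr A hne]
    have h1 := h.interval_mono b (Nat.succ_le_of_lt hjk) hy
    have h2 := h.abs_node_succ_sub b j
    have h3 := h.gap j
    rw [Nat.succ_eq_add_one] at h1
    have h4 := abs_sub_le (node A b (j + 1)) y (node A b j)
    rw [abs_sub_comm _ y] at h4
    linarith

end IsTreeScale


/-! ### John curves and their concatenation -/

section

variable {n : ℕ}

/-- `x` can be joined to `x₀` by a rectifiable curve in `Ω` that satisfies the `s`-John condition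
after a path of length `l` has been covered already. -/
def IsJohnJoined (s C : ℝ) (Ω : Set (EuclideanSpace ℝ (Fin n))) (x₀ : EuclideanSpace ℝ (Fin n))
    (l : ℝ) (x : EuclideanSpace ℝ (Fin n)) : Prop :=
  ∃ γ : ℝ → EuclideanSpace ℝ (Fin n),
    ContinuousOn γ (Set.Icc 0 1) ∧ Set.MapsTo γ (Set.Icc 0 1) Ω ∧ γ 0 = x ∧ γ 1 = x₀ ∧
    eVariationOn γ (Set.Icc 0 1) ≠ ⊤ ∧
    ∀ t ∈ Set.Icc (0 : ℝ) 1,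
      (l + (eVariationOn γ (Set.Icc 0 t)).toReal) ^ s ≤ C * Metric.infDist (γ t) (frontier Ω)

theorem IsJohnJoined.refl {s C : ℝ} {Ω : Set (EuclideanSpace ℝ (Fin n))}
    {x₀ : EuclideanSpace ℝ (Fin n)} {l : ℝ} (hx : x₀ ∈ Ω)
    (h : l ^ s ≤ C * Metric.infDist x₀ (frontier Ω)) : IsJohnJoined s C Ω x₀ l x₀ := by
  have h0 : ∀ S : Set ℝ, eVariationOn (fun _ : ℝ => x₀) S = 0 := fun S =>
    eVariationOn.constant_on (by
      rintro _ ⟨_, _, rfl⟩ _ ⟨_, _, rfl⟩; rfl)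
  exact ⟨fun _ => x₀, continuousOn_const, fun _ _ => hx, rfl, rfl, by simp [h0],
    fun t _ => by simpa [h0] using h⟩

theorem eVariationOn_lineMap_le (x y : EuclideanSpace ℝ (Fin n)) {t : ℝ} (ht : 0 ≤ t) :
    eVariationOn (AffineMap.lineMap (k := ℝ) x y) (Set.Icc 0 t) ≤ ENNReal.ofReal (t * dist x y) := by
  have h1 : LipschitzWith (nndist x y) (AffineMap.lineMap (k := ℝ) x y) :=
    lipschitzWith_lineMap x y
  have h2 := (h1.lipschitzOnWith (s := Set.univ)).comp_eVariationOn_le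
    (f := AffineMap.lineMap (k := ℝ) x y) (g := id) (s := Set.Icc 0 t) (Set.mapsTo_univ _ _)
  have h3 := (monotone_id.monotoneOn (Set.Icc (0 : ℝ) t)).eVariationOn_eq
    (a := 0) (b := t) ⟨le_rfl, ht⟩ ⟨ht, le_rfl⟩
  rw [Set.inter_self] at h3
  refine h2.trans ?_
  rw [h3, mul_comm t, ENNReal.ofReal_mul dist_nonneg, ← edist_dist, edist_nndist]
  simp

theorem eVariationOn_comp_affine (γ : ℝ → EuclideanSpace ℝ (Fin n)) (c : ℝ) (a b : ℝ) :
    eVariationOn (fun t => γ (2 * t - c)) (Set.Icc a b) =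
      eVariationOn γ (Set.Icc (2 * a - c) (2 * b - c)) := by
  have hm : MonotoneOn (fun t : ℝ => 2 * t - c) (Set.Icc a b) := fun x _ y _ h => by
    simp only; linarith
  have h := eVariationOn.comp_eq_of_monotoneOn γ _ hm
  have himg : (fun t : ℝ => 2 * t - c) '' Set.Icc a b = Set.Icc (2 * a - c) (2 * b - c) := by
    ext y
    constructor
    · rintro ⟨t, ⟨h1, h2⟩, rfl⟩
      constructor <;> simp only <;> linarith
    · rintro ⟨h1, h2⟩
      exact ⟨(y + c) / 2, ⟨by linarith, by linarith⟩, by simp only; ring⟩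
  rw [himg] at h
  exact h

/-- A segment along which the John condition holds can be put in front of a John curve. -/
theorem IsJohnJoined.segment {s C : ℝ} (hs : 0 ≤ s) {Ω : Set (EuclideanSpace ℝ (Fin n))}
    {x₀ x y : EuclideanSpace ℝ (Fin n)} {l l' : ℝ} (hl' : 0 ≤ l')
    (h : IsJohnJoined s C Ω x₀ l y) (hl : l' + dist x y ≤ l)
    (hmem : ∀ t ∈ Set.Icc (0 : ℝ) 1, AffineMap.lineMap x y t ∈ Ω)
    (hseg : ∀ t ∈ Set.Icc (0 : ℝ) 1, (l' + t * dist x y) ^ s ≤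
      C * Metric.infDist (AffineMap.lineMap x y t) (frontier Ω)) :
    IsJohnJoined s C Ω x₀ l' x := by
  obtain ⟨γ, hc, hm, h0, h1, hv, hd⟩ := h
  -- The segment and `γ` are run at double speed; the `- 0` gives both halves the form required by
  -- `eVariationOn_comp_affine`.
  set δ : ℝ → EuclideanSpace ℝ (Fin n) :=
    fun t => if t ≤ 1 / 2 then AffineMap.lineMap x y (2 * t - 0) else γ (2 * t - 1) with hδ
  have hL : Set.EqOn δ (fun t => AffineMap.lineMap x y (2 * t - 0)) (Set.Iic (1 / 2)) :=
    fun t ht => if_pos (Set.mem_Iic.1 ht)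
  have hR : Set.EqOn δ (fun t => γ (2 * t - 1)) (Set.Ici (1 / 2)) := fun t ht => by
    rcases eq_or_lt_of_le (show (1 / 2 : ℝ) ≤ t from ht) with rfl | ht
    · simp [hδ, h0]
    · simp only [hδ]; rw [if_neg (not_le.2 ht)]
  have hvL : ∀ t, 0 ≤ t → t ≤ 1 / 2 →
      eVariationOn δ (Set.Icc 0 t) ≤ ENNReal.ofReal (2 * t * dist x y) := fun t ht ht' => by
    rw [eVariationOn.eq_of_eqOn (hL.mono fun z hz => hz.2.trans ht'),
      eVariationOn_comp_affine (AffineMap.lineMap x y) 0]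
    simpa using eVariationOn_lineMap_le x y (t := 2 * t) (by linarith)
  have hvR : ∀ t, 1 / 2 ≤ t → eVariationOn δ (Set.Icc 0 t) ≤
      ENNReal.ofReal (dist x y) + eVariationOn γ (Set.Icc 0 (2 * t - 1)) := fun t ht => by
    have hadd := eVariationOn.Icc_add_Icc δ (s := Set.univ) (a := 0) (b := 1 / 2) (c := t)
      (by norm_num) ht (Set.mem_univ _)
    simp only [Set.univ_inter] at hadd
    rw [← hadd]
    refine add_le_add (by simpa using hvL (1 / 2) (by norm_num) le_rfl) ?_
    rw [eVariationOn.eq_of_eqOn (hR.mono fun z hz => hz.1), eVariationOn_comp_affine γ 1]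
    norm_num
  have hsub : ∀ t ≤ (1 : ℝ), eVariationOn γ (Set.Icc 0 t) ≠ ⊤ := fun t ht =>
    ne_top_of_le_ne_top hv (eVariationOn.mono γ (Set.Icc_subset_Icc_right ht))
  refine ⟨δ, ?_, ?_, ?_, ?_, ?_, ?_⟩
  · have h1 : ContinuousOn δ (Set.Icc 0 (1 / 2)) := by
      refine ContinuousOn.congr ?_ (hL.mono fun z hz => hz.2)
      exact (AffineMap.lineMap_continuous.comp (by fun_prop)).continuousOn
    have h2 : ContinuousOn δ (Set.Icc (1 / 2) 1) := by
      refine ContinuousOn.congr ?_ (hR.mono fun z hz => hz.1)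
      refine hc.comp (by fun_prop) fun t ht => ?_
      constructor <;> linarith [ht.1, ht.2]
    have h3 := h1.union_of_isClosed h2 isClosed_Icc isClosed_Icc
    rwa [Set.Icc_union_Icc_eq_Icc (by norm_num) (by norm_num)] at h3
  · intro t ht
    rcases le_total t (1 / 2) with h | h
    · rw [hL h]
      exact hmem _ ⟨by linarith [ht.1], by linarith⟩
    · rw [hR h]
      exact hm ⟨by linarith, by linarith [ht.2]⟩
  · rw [hL (by norm_num)]; simp
  · rw [hR (by norm_num)]; norm_num [h1]
  · exact ne_top_of_le_ne_top (ENNReal.add_ne_top.2 ⟨ENNReal.ofReal_ne_top, hsub _ (by norm_num)⟩)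
      (hvR 1 (by norm_num))
  · intro t ht
    rcases le_total t (1 / 2) with h | h
    · rw [hL h]
      refine le_trans (Real.rpow_le_rpow (by positivity) ?_ hs)
        (hseg (2 * t - 0) ⟨by linarith [ht.1], by linarith⟩)
      have := ENNReal.toReal_le_of_le_ofReal
        (mul_nonneg (by linarith [ht.1]) dist_nonneg) (hvL t ht.1 h)
      simpa using this
    · rw [hR h]
      refine le_trans (Real.rpow_le_rpow (by positivity) ?_ hs)
        (hd (2 * t - 1) ⟨by linarith, by linarith [ht.2]⟩)
      have hne := hsub (2 * t - 1) (by linarith [ht.2])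
      have := ENNReal.toReal_mono (ENNReal.add_ne_top.2 ⟨ENNReal.ofReal_ne_top, hne⟩) (hvR t h)
      rw [ENNReal.toReal_add ENNReal.ofReal_ne_top hne, ENNReal.toReal_ofReal dist_nonneg] at this
      linarith

/-- A bounded open set all of whose points are joined to `x₀` by John curves is a John domain. -/
theorem isSJohnDomain_of_forall_isJohnJoined {s C : ℝ} (hC : 0 < C)
    {Ω : Set (EuclideanSpace ℝ (Fin n))} {x₀ : EuclideanSpace ℝ (Fin n)} (ho : IsOpen Ω)
    (hb : Bornology.IsBounded Ω) (hx₀ : x₀ ∈ Ω) (h : ∀ x ∈ Ω, IsJohnJoined s C Ω x₀ 0 x) :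
    IsSJohnDomain s Ω x₀ := by
  refine ⟨ho, ⟨⟨x₀, hx₀⟩, isPreconnected_of_forall x₀ fun x hx => ?_⟩, hb, hx₀, C, hC,
    fun x hx => ?_⟩
  · obtain ⟨γ, hc, hm, h0, h1, -⟩ := h x hx
    exact ⟨γ '' Set.Icc 0 1, hm.image_subset, ⟨1, by simp, h1⟩, ⟨0, by simp, h0⟩,
      isPreconnected_Icc.image γ hc⟩
  · obtain ⟨γ, hc, hm, h0, h1, hv, hd⟩ := h x hx
    exact ⟨γ, hc, hm, h0, h1, hv, fun t ht => by simpa using hd t ⟨ht.1.le, ht.2⟩⟩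

theorem le_infDist_frontier {Ω : Set (EuclideanSpace ℝ (Fin n))} (ho : IsOpen Ω)
    (hne : (frontier Ω).Nonempty) {x : EuclideanSpace ℝ (Fin n)} {r : ℝ}
    (h : Metric.ball x r ⊆ Ω) : r ≤ Metric.infDist x (frontier Ω) := by
  rw [Metric.le_infDist hne]
  intro y hy
  by_contra! hlt
  have : y ∈ Ω := h (by rwa [Metric.mem_ball, dist_comm])
  rw [ho.frontier_eq] at hy
  exact hy.2 this

end

/-! ### Segments inside boxes -/

section

variable {n : ℕ}

/-- The open box with centre `a` and half-edges `b`. -/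
def openBox (a b : Fin n → ℝ) : Set (EuclideanSpace ℝ (Fin n)) := {x | ∀ i, |x i - a i| < b i}

theorem isOpen_openBox (a b : Fin n → ℝ) : IsOpen (openBox a b) := by
  simp only [openBox, Set.ofPred_forall]
  exact isOpen_iInter_of_finite fun i => isOpen_lt (by fun_prop) continuous_const

theorem abs_sub_apply_le_dist (x y : EuclideanSpace ℝ (Fin n)) (i : Fin n) :
    |x i - y i| ≤ dist x y := by
  rw [dist_eq_norm]
  exact PiLp.norm_apply_le (x - y) i

theorem dist_le_card_mul {x y : EuclideanSpace ℝ (Fin n)} {c : ℝ} (hc : 0 ≤ c)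
    (h : ∀ i, |x i - y i| ≤ c) : dist x y ≤ n * c := by
  rw [EuclideanSpace.dist_eq]
  refine Real.sqrt_le_iff.2 ⟨by positivity, ?_⟩
  calc ∑ i, dist (x i) (y i) ^ 2 ≤ ∑ _i : Fin n, c ^ 2 :=
        Finset.sum_le_sum fun i _ => by
          rw [Real.dist_eq]; exact pow_le_pow_left₀ (abs_nonneg _) (h i) 2
    _ = n * c ^ 2 := by simp
    _ ≤ (n * c) ^ 2 := by
        rw [mul_pow]
        refine mul_le_mul_of_nonneg_right ?_ (by positivity)
        exact_mod_cast Nat.le_self_pow two_ne_zero n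

theorem ball_subset_openBox {a b : Fin n → ℝ} {p : EuclideanSpace ℝ (Fin n)} {r : ℝ}
    (h : ∀ i, |p i - a i| + r ≤ b i) : Metric.ball p r ⊆ openBox a b := fun y hy i => by
  have h1 := abs_sub_apply_le_dist y p i
  have h2 := abs_sub_le (y i) (p i) (a i)
  have h3 := h i
  have h4 := Metric.mem_ball.1 hy
  linarith

/-- The distance to the faces of a box is concave along a segment. Equal margins at both ends
persist in between, and margin zero at `x` grows linearly towards `p`. -/
theorem lineMap_margin {a b : Fin n → ℝ} {x p : EuclideanSpace ℝ (Fin n)} {r r' t : ℝ}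
    (ht : t ∈ Set.Icc (0 : ℝ) 1) (hx : ∀ i, |x i - a i| + r' ≤ b i)
    (hp : ∀ i, |p i - a i| + r ≤ b i) (i : Fin n) :
    |(AffineMap.lineMap x p t : EuclideanSpace ℝ (Fin n)) i - a i| + ((1 - t) * r' + t * r)
      ≤ b i := by
  have h1 : (AffineMap.lineMap x p t : EuclideanSpace ℝ (Fin n)) i - a i =
      (1 - t) * (x i - a i) + t * (p i - a i) := by
    simp only [AffineMap.lineMap_apply_module, PiLp.add_apply, PiLp.smul_apply, smul_eq_mul]
    ring
  rw [h1]
  have h2 := abs_add_le ((1 - t) * (x i - a i)) (t * (p i - a i))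
  rw [abs_mul, abs_mul, abs_of_nonneg ht.1, abs_of_nonneg (sub_nonneg.2 ht.2)] at h2
  have h3 := mul_le_mul_of_nonneg_left (hx i) (sub_nonneg.2 ht.2)
  have h4 := mul_le_mul_of_nonneg_left (hp i) ht.1
  linarith

section Joined

variable {s C : ℝ} {Ω : Set (EuclideanSpace ℝ (Fin n))} {x₀ x p : EuclideanSpace ℝ (Fin n)}
  {a b : Fin n → ℝ} {r l l' : ℝ}

/-- A segment inside a box, at a fixed distance of its boundary, prolongs a John curve. -/
theorem IsJohnJoined.segment_of_margin (hs : 0 ≤ s) (hC : 0 ≤ C) (ho : IsOpen Ω)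
    (hne : (frontier Ω).Nonempty) (hbox : openBox a b ⊆ Ω) (hr : 0 < r) (hl' : 0 ≤ l')
    (h : IsJohnJoined s C Ω x₀ l p) (hl : l' + dist x p ≤ l)
    (hx : ∀ i, |x i - a i| + r ≤ b i) (hp : ∀ i, |p i - a i| + r ≤ b i) (hlr : l ^ s ≤ C * r) :
    IsJohnJoined s C Ω x₀ l' x := by
  have hball : ∀ t ∈ Set.Icc (0 : ℝ) 1, Metric.ball (AffineMap.lineMap x p t) r ⊆ Ω :=
    fun t ht => (ball_subset_openBox fun i => by
      have := lineMap_margin ht hx hp i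
      linarith).trans hbox
  refine h.segment hs hl' hl (fun t ht => hball t ht (Metric.mem_ball_self hr)) fun t ht => ?_
  have h1 : l' + t * dist x p ≤ l := by
    nlinarith [mul_nonneg (sub_nonneg.2 ht.2) (dist_nonneg (x := x) (y := p))]
  calc (l' + t * dist x p) ^ s ≤ l ^ s :=
        Real.rpow_le_rpow (add_nonneg hl' (mul_nonneg ht.1 dist_nonneg)) h1 hs
    _ ≤ C * r := hlr
    _ ≤ _ := mul_le_mul_of_nonneg_left (le_infDist_frontier ho hne (hball t ht)) hC

/-- A point of a box is joined to `x₀` if a point deep inside the box is. -/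
theorem IsJohnJoined.of_mem_openBox (hs : 1 ≤ s) (hC : 0 ≤ C) (ho : IsOpen Ω)
    (hne : (frontier Ω).Nonempty) (hbox : openBox a b ⊆ Ω) (hr : 0 < r)
    (h : IsJohnJoined s C Ω x₀ l p) (hl : dist x p ≤ l)
    (hx : x ∈ openBox a b) (hp : ∀ i, |p i - a i| + r ≤ b i) (hlr : l ^ s ≤ C * r) :
    IsJohnJoined s C Ω x₀ 0 x := by
  have hball : ∀ t ∈ Set.Icc (0 : ℝ) 1, Metric.ball (AffineMap.lineMap x p t) (t * r) ⊆ Ω :=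
    fun t ht => (ball_subset_openBox fun i => by
      have := lineMap_margin (r' := 0) ht (fun i => by simpa using (hx i).le) hp i
      linarith).trans hbox
  refine h.segment (by linarith) le_rfl (by simpa using hl) (fun t ht => ?_) fun t ht => ?_
  · rcases ht.1.eq_or_lt with rfl | ht0
    · simpa using hbox hx
    · exact hball t ht (Metric.mem_ball_self (by positivity))
  -- Near `x` the distance to the boundary is only known to grow linearly in `t`; since `s ≥ 1`, the
  -- `s`-th power of the length grows no faster.
  have hts : t ^ s ≤ t := by
    rcases ht.1.eq_or_lt with rfl | ht0
    · rw [Real.zero_rpow (by linarith)]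
    · simpa using Real.rpow_le_rpow_of_exponent_ge ht0 ht.2 hs
  have hl0 : 0 ≤ l := dist_nonneg.trans hl
  calc (0 + t * dist x p) ^ s ≤ (t * l) ^ s := by
        rw [zero_add]
        exact Real.rpow_le_rpow (mul_nonneg ht.1 dist_nonneg)
          (mul_le_mul_of_nonneg_left hl ht.1) (by linarith)
    _ = t ^ s * l ^ s := Real.mul_rpow ht.1 hl0
    _ ≤ t * (C * r) := mul_le_mul hts hlr (Real.rpow_nonneg hl0 s) ht.1
    _ = C * (t * r) := by ring
    _ ≤ _ := mul_le_mul_of_nonneg_left (le_infDist_frontier ho hne (hball t ht)) hC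

end Joined

/-! ### The tree domain: rooms, corridors and cells -/

/-- The node of level `k` with address `σ`. -/
def nodePoint (A : ℕ → ℝ) (σ : ℕ → Fin n → Bool) (k : ℕ) : EuclideanSpace ℝ (Fin n) :=
  WithLp.toLp 2 fun i => node A (fun j => σ j i) k

/-- The corner on the polygonal path from the node of level `k + 1` to its parent. -/
def joint (i₀ : Fin n) (A : ℕ → ℝ) (σ : ℕ → Fin n → Bool) (k : ℕ) : EuclideanSpace ℝ (Fin n) :=
  WithLp.toLp 2 fun i => node A (fun j => σ j i) (if i = i₀ then k else k + 1)

/-- The room around the node of level `k`, a box that is thin in direction `i₀`. -/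
def room (i₀ : Fin n) (A g : ℕ → ℝ) (σ : ℕ → Fin n → Bool) (k : ℕ) :
    Set (EuclideanSpace ℝ (Fin n)) :=
  openBox (fun i => node A (fun j => σ j i) k) fun i => if i = i₀ then g k else A k

/-- The corridor in direction `i₀` from the node of level `k + 1` to the room of its parent. -/
def tube (i₀ : Fin n) (s κ : ℝ) (A : ℕ → ℝ) (σ : ℕ → Fin n → Bool) (k : ℕ) :
    Set (EuclideanSpace ℝ (Fin n)) :=
  openBox (fun i => if i = i₀ then
      (node A (fun j => σ j i) k + node A (fun j => σ j i) (k + 1)) / 2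
      else node A (fun j => σ j i) (k + 1))
    fun i => if i = i₀ then (A k - A (k + 1)) / 2 + κ * A (k + 1) ^ s else κ * A (k + 1) ^ s

/-- The closed cube that contains everything below the node of level `k`. -/
def cell (A : ℕ → ℝ) (σ : ℕ → Fin n → Bool) (k : ℕ) : Set (EuclideanSpace ℝ (Fin n)) :=
  {x | ∀ i, |x i - node A (fun j => σ j i) k| ≤ A k}

/-- The tree-like domain made of all rooms and corridors. -/
def treeDomain (i₀ : Fin n) (s κ : ℝ) (A g : ℕ → ℝ) : Set (EuclideanSpace ℝ (Fin n)) :=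
  ⋃ (σ : ℕ → Fin n → Bool) (k : ℕ), room i₀ A g σ k ∪ tube i₀ s κ A σ k

section Tree

variable {i₀ i₁ : Fin n} {s κ L : ℝ} {A g : ℕ → ℝ}

theorem room_subset_treeDomain (σ : ℕ → Fin n → Bool) (k : ℕ) :
    room i₀ A g σ k ⊆ treeDomain i₀ s κ A g := fun _ hx =>
  Set.mem_iUnion₂.2 ⟨σ, k, Or.inl hx⟩

theorem tube_subset_treeDomain (σ : ℕ → Fin n → Bool) (k : ℕ) :
    tube i₀ s κ A σ k ⊆ treeDomain i₀ s κ A g := fun _ hx =>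
  Set.mem_iUnion₂.2 ⟨σ, k, Or.inr hx⟩

theorem isOpen_treeDomain : IsOpen (treeDomain i₀ s κ A g) :=
  isOpen_iUnion fun _ => isOpen_iUnion fun _ => (isOpen_openBox _ _).union (isOpen_openBox _ _)

namespace IsTreeScale

theorem cell_mono (h : IsTreeScale s κ L A g) (σ : ℕ → Fin n → Bool) {k l : ℕ} (hkl : k ≤ l) :
    cell A σ l ⊆ cell A σ k := fun _ hx i => h.interval_mono _ hkl (hx i)

theorem room_subset_cell (h : IsTreeScale s κ L A g) (σ : ℕ → Fin n → Bool) (k : ℕ) :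
    room i₀ A g σ k ⊆ cell A σ k := fun x hx i => by
  refine (hx i).le.trans ?_
  dsimp only
  split_ifs
  exacts [h.g_le k, le_rfl]

theorem tube_subset_cell (h : IsTreeScale s κ L A g) (σ : ℕ → Fin n → Bool) (k : ℕ) :
    tube i₀ s κ A σ k ⊆ cell A σ k := fun x hx i => by
  have hxi := hx i
  have h1 := h.abs_node_succ_sub (fun j => σ j i) k
  have h2 := h.width_le (k + 1)
  have h3 := h.two_mul_A_succ_le k
  have h4 := h.A_pos (k + 1)
  dsimp only at hxi
  split_ifs at hxi
  · have h5 := abs_sub_le (x i)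
      ((node A (fun j => σ j i) k + node A (fun j => σ j i) (k + 1)) / 2)
      (node A (fun j => σ j i) k)
    have h6 : (node A (fun j => σ j i) k + node A (fun j => σ j i) (k + 1)) / 2 -
      node A (fun j => σ j i) k =
        (node A (fun j => σ j i) (k + 1) - node A (fun j => σ j i) k) / 2 := by ring
    rw [h6, abs_div, h1, abs_two] at h5
    linarith
  · have h5 := abs_sub_le (x i) (node A (fun j => σ j i) (k + 1)) (node A (fun j => σ j i) k)
    linarith

theorem treeDomain_subset_cell (h : IsTreeScale s κ L A g) {x : EuclideanSpace ℝ (Fin n)}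
    (hx : x ∈ treeDomain i₀ s κ A g) (i : Fin n) : |x i| ≤ A 0 := by
  obtain ⟨σ, k, hx⟩ := Set.mem_iUnion₂.1 hx
  have : x ∈ cell A σ 0 := h.cell_mono σ (Nat.zero_le k)
    (hx.elim (fun hx => h.room_subset_cell σ k hx) fun hx => h.tube_subset_cell σ k hx)
  simpa using this i

theorem isBounded_treeDomain (h : IsTreeScale s κ L A g) :
    Bornology.IsBounded (treeDomain i₀ s κ A g) := by
  refine (Metric.isBounded_closedBall (x := 0) (r := n * A 0)).subset fun x hx => ?_
  exact dist_le_card_mul (h.A_pos 0).le fun i => by simpa using h.treeDomain_subset_cell hx i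

/-- A point of the domain outside the corridors of level `k` lies in a cell of level `k + 1` or is
far from all these cells. -/
theorem mem_cell_or_far (h : IsTreeScale s κ L A g) (hi : i₁ ≠ i₀) {k : ℕ}
    {x : EuclideanSpace ℝ (Fin n)} (hx : x ∈ treeDomain i₀ s κ A g)
    (hxt : ∀ σ, x ∉ tube i₀ s κ A σ k) :
    (∃ σ, x ∈ cell A σ (k + 1)) ∨ ∀ σ, ∀ y ∈ cell A σ (k + 1), g k ≤ dist x y := by
  obtain ⟨σ, j, hx⟩ := Set.mem_iUnion₂.1 hx
  rcases hx with hx | hx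
  · rcases lt_or_ge k j with hkj | hjk
    · exact Or.inl ⟨σ, h.cell_mono σ hkj (h.room_subset_cell σ j hx)⟩
    · refine Or.inr fun σ' y hy => ?_
      have h1 := hx i₀
      simp only [if_true] at h1
      -- In direction `i₀` the deeper cells are `2 * g j` away from the node, and the room uses up
      -- at most `g j` of this.
      have h2 := h.sep_node (fun j => σ j i₀) _ (Nat.lt_succ_of_le hjk) (hy i₀)
      have h3 := abs_sub_le (y i₀) (x i₀) (node A (fun j => σ j i₀) j)
      rw [abs_sub_comm (y i₀) (x i₀)] at h3
      linarith [h.g_anti hjk, abs_sub_apply_le_dist x y i₀]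
  · rcases lt_trichotomy k j with hkj | rfl | hjk
    · exact Or.inl ⟨σ, h.cell_mono σ hkj (h.tube_subset_cell σ j hx)⟩
    · exact absurd hx (hxt σ)
    · refine Or.inr fun σ' y hy => ?_
      -- A corridor is long in direction `i₀`, so the separation is read off in another direction,
      -- where it stays within `g (j + 1)` of the node of level `j + 1`.
      have h1 := hx i₁
      simp only [if_neg hi] at h1
      have h2 := h.sep_node (fun j => σ j i₁) _ (show j + 1 < k + 1 by omega) (hy i₁)
      have h3 := abs_sub_le (y i₁) (x i₁) (node A (fun j => σ j i₁) (j + 1))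
      rw [abs_sub_comm (y i₁) (x i₁)] at h3
      linarith [h.g_anti (show j + 1 ≤ k from hjk), abs_sub_apply_le_dist x y i₁, h.width (j + 1)]

/-- Points of cells of positive level are off the hyperplanes through the origin. -/
theorem two_mul_g_zero_le (h : IsTreeScale s κ L A g) (σ : ℕ → Fin n → Bool) {k : ℕ} (hk : 0 < k)
    {x : EuclideanSpace ℝ (Fin n)} (hx : x ∈ cell A σ k) (i : Fin n) : 2 * g 0 ≤ |x i| := by
  simpa using h.sep_node (fun j => σ j i) _ hk (hx i)

theorem zero_mem_treeDomain (h : IsTreeScale s κ L A g) : 0 ∈ treeDomain i₀ s κ A g := by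
  refine room_subset_treeDomain (fun _ _ => true) 0 fun i => ?_
  simp only [PiLp.zero_apply, node_zero, sub_zero, abs_zero]
  split_ifs
  exacts [h.g_pos 0, h.A_pos 0]

/-- An explicit boundary point at distance `g 0` from the John centre. It shows that the frontier is
nonempty and limits the size of a central Whitney cube. It lies on a face of the root room, and its
vanishing `i₁`-coordinate keeps it out of every cell of positive level and every corridor of level
zero. -/
theorem single_mem_frontier (h : IsTreeScale s κ L A g) (hi : i₁ ≠ i₀) :
    EuclideanSpace.single i₀ (g 0) ∈ frontier (treeDomain i₀ s κ A g) := by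
  rw [isOpen_treeDomain.frontier_eq]
  have hg := h.g_pos 0
  constructor
  · have ht : Filter.Tendsto (fun t : ℝ => t • EuclideanSpace.single i₀ (g 0)) (𝓝[<] 1)
        (𝓝 ((1 : ℝ) • EuclideanSpace.single i₀ (g 0))) :=
      ((continuous_id.smul continuous_const).tendsto 1).mono_left nhdsWithin_le_nhds
    rw [one_smul] at ht
    refine mem_closure_of_tendsto ht ?_
    filter_upwards [Ioo_mem_nhdsLT (show (0 : ℝ) < 1 by norm_num)] with t hti
    refine room_subset_treeDomain (fun _ _ => true) 0 fun i => ?_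
    by_cases hii : i = i₀
    · subst hii
      simp only [PiLp.smul_apply, PiLp.single_apply, node_zero, sub_zero, smul_eq_mul,
        if_true]
      rw [abs_of_pos (mul_pos hti.1 hg)]
      nlinarith [hti.2]
    · simp [hii, h.A_pos 0]
  · intro hmem
    obtain ⟨σ, k, hx⟩ := Set.mem_iUnion₂.1 hmem
    have hcell : ∀ k, 0 < k → EuclideanSpace.single i₀ (g 0) ∉ cell A σ k := fun k hk hc => by
      have := h.two_mul_g_zero_le σ hk hc i₁
      rw [PiLp.single_apply, if_neg hi, abs_zero] at this
      linarith
    rcases Nat.eq_zero_or_pos k with rfl | hk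
    · rcases hx with hx | hx
      · have := hx i₀
        simp [abs_of_pos hg] at this
      · have h1 := hx i₁
        simp only [PiLp.single_apply, if_neg hi, zero_add] at h1
        have h2 := h.sep_node (fun j => σ j i₁) _ zero_lt_one (h1.le.trans (h.width_le 1))
        simp only [node_zero, sub_zero, abs_zero] at h2
        linarith
    · exact hcell k hk
        (hx.elim (fun hx => h.room_subset_cell σ k hx) fun hx => h.tube_subset_cell σ k hx)

end IsTreeScale

end Tree

end

/-! ### The John condition for the tree domain -/

section

variable {n : ℕ} {i₀ i₁ : Fin n} {s κ L : ℝ} {A g : ℕ → ℝ}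

namespace IsTreeScale

theorem L_pos (h : IsTreeScale s κ L A g) : 0 < L := by
  have h1 := h.ratio 0
  have h2 := h.A_pos 0
  have h3 := h.A_pos (0 + 1)
  by_contra! hL
  nlinarith

theorem width_anti (h : IsTreeScale s κ L A g) (hs : 0 ≤ s) {k l : ℕ} (hkl : k ≤ l) :
    κ * A l ^ s ≤ κ * A k ^ s :=
  mul_le_mul_of_nonneg_left (Real.rpow_le_rpow (h.A_pos l).le (h.A_anti hkl) hs) h.κ_pos.le

/-- The constant of the John condition for `treeDomain`. -/
theorem rpow_le_width (h : IsTreeScale s κ L A g) (hs : 0 ≤ s) {l : ℝ} (hl0 : 0 ≤ l) {k : ℕ}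
    (hl : l ≤ 2 * n * A k) : l ^ s ≤ (2 * n * L) ^ s / κ * (κ * A (k + 1) ^ s) := by
  have hL := h.L_pos
  have h1 : l ≤ 2 * n * L * A (k + 1) := by
    refine hl.trans ?_
    rw [mul_assoc (2 * (n : ℝ))]
    exact mul_le_mul_of_nonneg_left (h.ratio k) (by positivity)
  calc l ^ s ≤ (2 * n * L * A (k + 1)) ^ s := Real.rpow_le_rpow hl0 h1 hs
    _ = (2 * n * L) ^ s * A (k + 1) ^ s :=
        Real.mul_rpow (by positivity) (h.A_pos _).le
    _ = _ := by
        have := h.κ_pos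
        field_simp

/-- With the next three lemmas: both legs of the path from a node to its parent, through the
corridor and then through the room, have end points with margin `κ * A (k + 1) ^ s` in the
respective box. -/
theorem node_room_margin (h : IsTreeScale s κ L A g) (hs : 0 ≤ s) (σ : ℕ → Fin n → Bool) (k : ℕ)
    (i : Fin n) : |nodePoint A σ k i - node A (fun j => σ j i) k| + κ * A (k + 1) ^ s ≤
      if i = i₀ then g k else A k := by
  have h1 := h.width_anti hs (Nat.le_succ k)
  have h2 := h.width k
  have h3 := h.g_le k
  simp only [nodePoint, sub_self, abs_zero, zero_add]
  split_ifs <;> linarith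

theorem joint_room_margin (h : IsTreeScale s κ L A g) (hs : 0 ≤ s) (σ : ℕ → Fin n → Bool) (k : ℕ)
    (i : Fin n) : |joint i₀ A σ k i - node A (fun j => σ j i) k| + κ * A (k + 1) ^ s ≤
      if i = i₀ then g k else A k := by
  have h1 := h.width_anti hs (Nat.le_succ k)
  have h2 := h.width k
  have h4 := h.width_le (k + 1)
  have h3 := h.abs_node_succ_sub (fun j => σ j i) k
  simp only [joint]
  split_ifs
  · simpa using h1.trans h2
  · rw [h3]; linarith

theorem joint_tube_margin (h : IsTreeScale s κ L A g) (σ : ℕ → Fin n → Bool) (k : ℕ)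
    (i : Fin n) : |joint i₀ A σ k i - (if i = i₀ then
      (node A (fun j => σ j i) k + node A (fun j => σ j i) (k + 1)) / 2
      else node A (fun j => σ j i) (k + 1))| + κ * A (k + 1) ^ s ≤
      if i = i₀ then (A k - A (k + 1)) / 2 + κ * A (k + 1) ^ s else κ * A (k + 1) ^ s := by
  have h3 := h.abs_node_succ_sub (fun j => σ j i) k
  simp only [joint]
  split_ifs
  · have h6 : node A (fun j => σ j i) k -
      (node A (fun j => σ j i) k + node A (fun j => σ j i) (k + 1)) / 2 =
        -((node A (fun j => σ j i) (k + 1) - node A (fun j => σ j i) k) / 2) := by ring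
    rw [h6, abs_neg, abs_div, h3, abs_two]
  · simp

theorem node_tube_margin (h : IsTreeScale s κ L A g) (σ : ℕ → Fin n → Bool) (k : ℕ)
    (i : Fin n) : |nodePoint A σ (k + 1) i - (if i = i₀ then
      (node A (fun j => σ j i) k + node A (fun j => σ j i) (k + 1)) / 2
      else node A (fun j => σ j i) (k + 1))| + κ * A (k + 1) ^ s ≤
      if i = i₀ then (A k - A (k + 1)) / 2 + κ * A (k + 1) ^ s else κ * A (k + 1) ^ s := by
  have h3 := h.abs_node_succ_sub (fun j => σ j i) k
  simp only [nodePoint]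
  split_ifs
  · have h6 : node A (fun j => σ j i) (k + 1) -
      (node A (fun j => σ j i) k + node A (fun j => σ j i) (k + 1)) / 2 =
        (node A (fun j => σ j i) (k + 1) - node A (fun j => σ j i) k) / 2 := by ring
    rw [h6, abs_div, h3, abs_two]
  · simp

theorem dist_node_joint_le (h : IsTreeScale s κ L A g) (σ : ℕ → Fin n → Bool) (k : ℕ) :
    dist (nodePoint A σ (k + 1)) (joint i₀ A σ k) ≤ n * (A k - A (k + 1)) := by
  refine dist_le_card_mul (sub_nonneg.2 (h.A_succ_le k)) fun i => ?_
  simp only [nodePoint, joint]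
  split_ifs
  · exact (h.abs_node_succ_sub _ k).le
  · simpa using h.A_succ_le k

theorem dist_joint_node_le (h : IsTreeScale s κ L A g) (σ : ℕ → Fin n → Bool) (k : ℕ) :
    dist (joint i₀ A σ k) (nodePoint A σ k) ≤ n * (A k - A (k + 1)) := by
  refine dist_le_card_mul (sub_nonneg.2 (h.A_succ_le k)) fun i => ?_
  simp only [nodePoint, joint]
  split_ifs
  · simpa using h.A_succ_le k
  · exact (h.abs_node_succ_sub _ k).le

theorem isJohnJoined_joint_of_node (h : IsTreeScale s κ L A g) (hs : 0 ≤ s) (hi : i₁ ≠ i₀)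
    (σ : ℕ → Fin n → Bool) (k : ℕ)
    (hn : IsJohnJoined s ((2 * n * L) ^ s / κ) (treeDomain i₀ s κ A g) 0 (2 * n * A k)
      (nodePoint A σ k)) :
    IsJohnJoined s ((2 * n * L) ^ s / κ) (treeDomain i₀ s κ A g) 0 (n * (A k + A (k + 1)))
      (joint i₀ A σ k) := by
  have := h.κ_pos
  have := h.L_pos
  have hA := h.A_pos k
  have hA' := h.A_pos (k + 1)
  refine hn.segment_of_margin hs (by positivity) isOpen_treeDomain ⟨_, h.single_mem_frontier hi⟩
    (room_subset_treeDomain σ k) (h.width_pos (k + 1)) (by positivity) ?_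
    (h.joint_room_margin hs σ k) (h.node_room_margin hs σ k)
    (h.rpow_le_width hs (by positivity) le_rfl)
  linarith [h.dist_joint_node_le (i₀ := i₀) σ k]

/-- Each of the two legs to the parent has length at most `n * (A k - A (k + 1))`, so an allowance
of `2 * n * A (k + 1)` for the length already covered becomes `2 * n * A k`, the allowance at the
parent. -/
theorem isJohnJoined_node (h : IsTreeScale s κ L A g) (hs : 0 ≤ s) (hi : i₁ ≠ i₀)
    (σ : ℕ → Fin n → Bool) (k : ℕ) :
    IsJohnJoined s ((2 * n * L) ^ s / κ) (treeDomain i₀ s κ A g) 0 (2 * n * A k)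
      (nodePoint A σ k) := by
  have := h.κ_pos
  have := h.L_pos
  have hne : (frontier (treeDomain i₀ s κ A g)).Nonempty := ⟨_, h.single_mem_frontier hi⟩
  induction k with
  | zero =>
    have hA := h.A_pos 0
    have h0 : nodePoint A σ 0 = 0 := by ext i; simp [nodePoint]
    have hball := (ball_subset_openBox (h.node_room_margin (i₀ := i₀) hs σ 0)).trans
      (room_subset_treeDomain (s := s) (κ := κ) σ 0)
    rw [h0] at hball ⊢
    refine .refl h.zero_mem_treeDomain
      ((h.rpow_le_width hs (by positivity) le_rfl).trans
        (mul_le_mul_of_nonneg_left (le_infDist_frontier isOpen_treeDomain hne hball)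
          (by positivity)))
  | succ k ih =>
    have hA := h.A_pos k
    have hA' := h.A_pos (k + 1)
    refine (h.isJohnJoined_joint_of_node hs hi σ k ih).segment_of_margin hs (by positivity)
      isOpen_treeDomain hne (tube_subset_treeDomain σ k) (h.width_pos (k + 1)) (by positivity) ?_
      (h.node_tube_margin σ k) (h.joint_tube_margin σ k)
      (h.rpow_le_width hs (by positivity) ?_)
    · linarith [h.dist_node_joint_le (i₀ := i₀) σ k]
    · nlinarith [h.A_succ_le k, Nat.cast_nonneg (α := ℝ) n]

theorem isSJohnDomain_treeDomain (h : IsTreeScale s κ L A g) (hs : 1 ≤ s) (hi : i₁ ≠ i₀) :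
    IsSJohnDomain s (treeDomain i₀ s κ A g) 0 := by
  have hκ := h.κ_pos
  have hL := h.L_pos
  have hs0 : 0 ≤ s := by linarith
  have hn : (0 : ℝ) < n := by exact_mod_cast i₀.pos
  have hne : (frontier (treeDomain i₀ s κ A g)).Nonempty := ⟨_, h.single_mem_frontier hi⟩
  refine isSJohnDomain_of_forall_isJohnJoined (C := (2 * n * L) ^ s / κ) (by positivity)
    isOpen_treeDomain h.isBounded_treeDomain h.zero_mem_treeDomain fun x hx => ?_
  obtain ⟨σ, k, hx⟩ := Set.mem_iUnion₂.1 hx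
  have hA := h.A_pos k
  have hA' := h.A_pos (k + 1)
  have hnode := h.isJohnJoined_node hs0 hi σ k
  rcases hx with hx | hx
  · refine hnode.of_mem_openBox hs (by positivity) isOpen_treeDomain hne
      (room_subset_treeDomain σ k) (h.width_pos (k + 1)) ?_ hx (h.node_room_margin hs0 σ k)
      (h.rpow_le_width hs0 (by positivity) le_rfl)
    have h1 : dist x (nodePoint A σ k) ≤ n * A k :=
      dist_le_card_mul hA.le fun i => h.room_subset_cell σ k hx i
    linarith [mul_pos hn hA]
  · refine (h.isJohnJoined_joint_of_node hs0 hi σ k hnode).of_mem_openBox hs (by positivity)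
      isOpen_treeDomain hne (tube_subset_treeDomain σ k) (h.width_pos (k + 1)) ?_ hx
      (h.joint_tube_margin σ k) (h.rpow_le_width hs0 (by positivity) ?_)
    · have h1 : dist x (joint i₀ A σ k) ≤ n * A k := by
        refine dist_le_card_mul hA.le fun i => ?_
        have h2 := h.width_le (k + 1)
        have h3 := h.two_mul_A_succ_le k
        have hxi := hx i
        by_cases hii : i = i₀
        · have := h.tube_subset_cell σ k hx i
          simpa [joint, hii] using this
        · simp only [joint, hii, if_false] at hxi ⊢
          linarith
      linarith [mul_pos hn hA']
    · nlinarith [h.A_succ_le k]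

end IsTreeScale

end

/-! ### Capacity: truncated distance functions -/

section

open MeasureTheory

variable {n : ℕ}

/-- A Lipschitz function belongs to `W^{1,p}_loc`, and its weak gradient is the classical one. -/
theorem memW1pLoc_of_lipschitzWith (p : ℝ) (Ω : Set (EuclideanSpace ℝ (Fin n))) {C : ℝ≥0}
    {u : EuclideanSpace ℝ (Fin n) → ℝ} (hu : LipschitzWith C u) :
    MemW1pLoc p Ω u (gradient u) := by
  have hnorm : ∀ x, ‖gradient u x‖ ≤ C := fun x => by
    rw [gradient, LinearIsometryEquiv.norm_map]
    exact norm_fderiv_le_of_lipschitz ℝ hu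
  refine ⟨fun K _ hK => ?_, fun K _ hK => ?_, fun φ hφ hc hsupp v => ?_⟩
  · have : IsFiniteMeasure (volume.restrict K) := ⟨by simpa using hK.measure_lt_top⟩
    obtain ⟨M, hM⟩ := hK.exists_bound_of_continuousOn hu.continuous.continuousOn
    exact MemLp.of_bound hu.continuous.aestronglyMeasurable M
      ((ae_restrict_iff' hK.measurableSet).2 (.of_forall hM))
  · have : IsFiniteMeasure (volume.restrict K) := ⟨by simpa using hK.measure_lt_top⟩
    refine MemLp.of_bound ?_ C (.of_forall hnorm)
    have : Measurable (gradient u) :=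
      ((InnerProductSpace.toDual ℝ _).symm.continuous.measurable).comp (measurable_fderiv ℝ u)
    exact this.aestronglyMeasurable
  · obtain ⟨D, hD⟩ := ContDiff.lipschitzWith_of_hasCompactSupport hc hφ (by simp)
    have h1 : ∫ x in Ω, u x * fderiv ℝ φ x v = ∫ x, u x * fderiv ℝ φ x v :=
      setIntegral_eq_integral_of_forall_compl_eq_zero fun x hx => by
        have : x ∉ tsupport (fderiv ℝ φ) := fun h => hx (hsupp (tsupport_fderiv_subset ℝ h))
        simp [image_eq_zero_of_notMem_tsupport this]
    have h2 : ∫ x in Ω, inner ℝ (gradient u x) v * φ x = ∫ x, inner ℝ (gradient u x) v * φ x :=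
      setIntegral_eq_integral_of_forall_compl_eq_zero fun x hx => by
        have : x ∉ tsupport φ := fun h => hx (hsupp h)
        simp [image_eq_zero_of_notMem_tsupport this]
    have h3 := hu.integral_lineDeriv_mul_eq (μ := volume) hD hc v
    have h4 : ∫ x, lineDeriv ℝ u x v * φ x = ∫ x, inner ℝ (gradient u x) v * φ x := by
      refine integral_congr_ae ?_
      -- Rademacher's theorem identifies the directional derivative with the gradient almost
      -- everywhere.
      filter_upwards [hu.ae_differentiableAt (μ := volume)] with x hx
      rw [hx.lineDeriv_eq_fderiv, gradient, InnerProductSpace.toDual_symm_apply]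
    have h5 : ∀ x, lineDeriv ℝ φ x (-v) * u x = -(u x * fderiv ℝ φ x v) := fun x => by
      rw [((hφ.differentiable (by simp)) x).lineDeriv_eq_fderiv, map_neg]
      ring
    rw [h1, h2, ← h4, h3]
    simp only [h5, integral_neg, neg_neg]

/-- The gradient of a function with values in `[0, 1]` vanishes where the value is `0` or `1`. -/
theorem gradient_eq_zero_of_extreme {u : EuclideanSpace ℝ (Fin n) → ℝ} (h0 : ∀ x, 0 ≤ u x)
    (h1 : ∀ x, u x ≤ 1) {x : EuclideanSpace ℝ (Fin n)} (hx : u x = 0 ∨ u x = 1) :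
    gradient u x = 0 := by
  have : fderiv ℝ u x = 0 := by
    rcases hx with hx | hx
    · exact IsLocalMin.fderiv_eq_zero (.of_forall fun y => hx ▸ h0 y)
    · exact IsLocalMax.fderiv_eq_zero (.of_forall fun y => hx ▸ h1 y)
  rw [gradient, this, map_zero]

/-- The capacity bound given by a truncated distance function. -/
theorem capacity_le_of_far {p η : ℝ} (hp : 0 < p) (hη : 0 < η)
    {E F Ω S T : Set (EuclideanSpace ℝ (Fin n))} (hΩ : MeasurableSet Ω) (hT : MeasurableSet T)
    (hS : S.Nonempty) (hE : E ⊆ S) (hF : ∀ x ∈ F, ∀ y ∈ S, η ≤ dist x y)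
    (hΩT : ∀ x ∈ Ω, x ∉ T → x ∈ S ∨ ∀ y ∈ S, η ≤ dist x y) :
    capacity p E F Ω ≤ ENNReal.ofReal (η ^ (-p)) * volume T := by
  set u : EuclideanSpace ℝ (Fin n) → ℝ := fun x => min 1 (Metric.infDist x S / η) with hu
  have hlip : LipschitzWith (Real.toNNReal η⁻¹) u := by
    have h1 : LipschitzWith (Real.toNNReal η⁻¹) fun x => Metric.infDist x S / η := by
      refine LipschitzWith.of_dist_le_mul fun x y => ?_
      rw [Real.coe_toNNReal _ (by positivity), Real.dist_eq, ← sub_div, abs_div, abs_of_pos hη,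
        div_eq_inv_mul]
      refine mul_le_mul_of_nonneg_left ?_ (by positivity)
      simpa [Real.dist_eq] using (Metric.lipschitz_infDist_pt S).dist_le_mul x y
    simpa [hu] using h1.const_min 1
  have h0 : ∀ x, 0 ≤ u x := fun x => le_min zero_le_one (div_nonneg Metric.infDist_nonneg hη.le)
  have h1 : ∀ x, u x ≤ 1 := fun x => min_le_left _ _
  have hzero : ∀ x ∈ S, u x = 0 := fun x hx => by simp [hu, Metric.infDist_zero_of_mem hx]
  have hone : ∀ x, (∀ y ∈ S, η ≤ dist x y) → u x = 1 := fun x hx =>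
    min_eq_left ((one_le_div hη).2 ((Metric.le_infDist hS).2 hx))
  refine (iInf₂_le u (gradient u)).trans ((iInf_le _ ⟨hlip.continuous.continuousOn,
    memW1pLoc_of_lipschitzWith p Ω hlip, fun x hx => (hzero x (hE hx)).le,
    fun x hx => (hone x (hF x hx)).ge⟩).trans ?_)
  calc ∫⁻ x in Ω, ‖gradient u x‖ₑ ^ p
      ≤ ∫⁻ x in Ω, T.indicator (fun _ => ENNReal.ofReal (η ^ (-p))) x := by
        refine setLIntegral_mono' hΩ fun x hx => ?_
        by_cases hxT : x ∈ T
        · rw [Set.indicator_of_mem hxT, Real.rpow_neg hη.le, ← Real.inv_rpow hη.le,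
            ← ENNReal.ofReal_rpow_of_nonneg (by positivity) hp.le]
          refine ENNReal.rpow_le_rpow ?_ hp.le
          rw [← ofReal_norm, gradient, LinearIsometryEquiv.norm_map]
          refine ENNReal.ofReal_le_ofReal ?_
          simpa [hη.le] using norm_fderiv_le_of_lipschitz ℝ hlip (x₀ := x)
        -- Off `T` the function takes an extreme value, and `fderiv` vanishes at an extremum even
        -- without differentiability; so the boundary of `S` needs no separate treatment.
        · rw [Set.indicator_of_notMem hxT, gradient_eq_zero_of_extreme h0 h1
            ((hΩT x hx hxT).imp (hzero x) (hone x))]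
          simp [hp]
    _ ≤ ∫⁻ x, T.indicator (fun _ => ENNReal.ofReal (η ^ (-p))) x := setLIntegral_le_lintegral _ _
    _ = _ := lintegral_indicator_const hT _

theorem volume_openBox (a b : Fin n → ℝ) :
    volume (openBox a b) = ∏ i, ENNReal.ofReal (2 * b i) := by
  have h : openBox a b =
      WithLp.ofLp ⁻¹' (Set.univ.pi fun i => Set.Ioo (a i - b i) (a i + b i)) := by
    ext x
    simp only [openBox, Set.mem_ofPred_eq, Set.mem_preimage, Set.mem_univ_pi, Set.mem_Ioo, abs_lt]
    exact forall_congr' fun i => ⟨fun h => ⟨by linarith, by linarith⟩,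
      fun h => ⟨by linarith, by linarith⟩⟩
  rw [h, (PiLp.volume_preserving_ofLp (Fin n)).measure_preimage
    (MeasurableSet.univ_pi fun i => measurableSet_Ioo).nullMeasurableSet, Real.volume_pi_Ioo]
  exact Finset.prod_congr rfl fun i _ => by congr 1; ring

/-- The address that extends a finite one. -/
def extendAddress {k : ℕ} (τ : Fin k → Fin n → Bool) (j : ℕ) (i : Fin n) : Bool :=
  if h : j < k then τ ⟨j, h⟩ i else true

theorem node_extendAddress (A : ℕ → ℝ) (σ : ℕ → Fin n → Bool) {k l : ℕ} (hl : l ≤ k) (i : Fin n) :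
    node A (fun j => extendAddress (fun j : Fin k => σ j) j i) l = node A (fun j => σ j i) l :=
  node_congr A fun j hj => by simp [extendAddress, hj.trans_le hl]

section Tree

variable {i₀ i₁ : Fin n} {s κ L : ℝ} {A g : ℕ → ℝ}

/-- A corridor of level `k` depends on the first `k + 1` letters only, so there are at most `(2 ^ n)
^ (k + 1)` of them, and the default letter of `extendAddress` is immaterial. -/
theorem tube_extendAddress (σ : ℕ → Fin n → Bool) (k : ℕ) :
    tube i₀ s κ A (extendAddress fun j : Fin (k + 1) => σ j) k = tube i₀ s κ A σ k := by
  simp only [tube, node_extendAddress A σ (Nat.le_succ k), node_extendAddress A σ (le_refl (k + 1))]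

namespace IsTreeScale

theorem volume_tube_le (h : IsTreeScale s κ L A g) (hs : 0 ≤ s) (σ : ℕ → Fin n → Bool) (k : ℕ) :
    volume (tube i₀ s κ A σ k) ≤
      ENNReal.ofReal ((2 * κ) ^ (n - 1) * 3 * ((A k ^ s) ^ (n - 1) * A k)) := by
  have hw := h.width_pos (k + 1)
  have hA := h.A_pos k
  rw [tube, volume_openBox, ← Finset.mul_prod_erase _ _ (Finset.mem_univ i₀),
    Finset.prod_congr rfl fun i hi => by
      rw [if_neg (Finset.ne_of_mem_erase hi)], Finset.prod_const,
    Finset.card_erase_of_mem (Finset.mem_univ _), Finset.card_univ, Fintype.card_fin, if_pos rfl,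
    ← ENNReal.ofReal_pow (by positivity),
    ← ENNReal.ofReal_mul (by linarith [h.A_succ_le k])]
  refine ENNReal.ofReal_le_ofReal ?_
  calc 2 * ((A k - A (k + 1)) / 2 + κ * A (k + 1) ^ s) * (2 * (κ * A (k + 1) ^ s)) ^ (n - 1)
      ≤ (3 * A k) * (2 * (κ * A k ^ s)) ^ (n - 1) := by
        have h1 := h.width_anti hs (Nat.le_succ k)
        have h2 := h.width_le (k + 1)
        have h3 := h.two_mul_A_succ_le k
        have h4 := h.A_pos (k + 1)
        have h5 : (2 * (κ * A (k + 1) ^ s)) ^ (n - 1) ≤ (2 * (κ * A k ^ s)) ^ (n - 1) :=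
          pow_le_pow_left₀ (by positivity) (by linarith) _
        exact mul_le_mul (by linarith) h5 (by positivity) (by positivity)
    _ = _ := by
        rw [← mul_assoc 2 κ, mul_pow]
        ring

/-- The energy of the truncated distance functions bounds the capacities. -/
theorem capacity_le (h : IsTreeScale s κ L A g) (hs : 0 ≤ s) (hi : i₁ ≠ i₀) {p : ℝ} (hp : 0 < p)
    {E F : Set (EuclideanSpace ℝ (Fin n))} {k : ℕ} (hE : ∀ x ∈ E, ∃ σ, x ∈ cell A σ (k + 1))
    (hF : ∀ x ∈ F, |x i₀| ≤ g 0) :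
    capacity p E F (treeDomain i₀ s κ A g) ≤
      ENNReal.ofReal (2 ^ n * ((2 * κ) ^ (n - 1) * 3) *
        ((2 ^ n) ^ k * (A k ^ s) ^ (n - 1) * A k * g k ^ (-p))) := by
  have hκ := h.κ_pos
  have hA := h.A_pos k
  have hg := h.g_pos k
  set T := ⋃ τ : Fin (k + 1) → Fin n → Bool, tube i₀ s κ A (extendAddress τ) k with hT
  have hvol : volume T ≤ ENNReal.ofReal ((2 ^ n) ^ (k + 1) *
      ((2 * κ) ^ (n - 1) * 3 * ((A k ^ s) ^ (n - 1) * A k))) := by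
    refine (measure_iUnion_fintype_le _ _).trans
      ((Finset.sum_le_sum fun τ _ => h.volume_tube_le hs _ k).trans ?_)
    rw [Finset.sum_const, Finset.card_univ, nsmul_eq_mul,
      ENNReal.ofReal_mul (p := (2 ^ n) ^ (k + 1)) (by positivity)]
    refine le_of_eq ?_
    congr 1
    rw [ENNReal.ofReal_pow (by positivity), ENNReal.ofReal_pow (by positivity)]
    simp
  refine (capacity_le_of_far (S := ⋃ σ, cell A σ (k + 1)) (T := T) hp hg
    isOpen_treeDomain.measurableSet
    (MeasurableSet.iUnion fun τ => (isOpen_openBox _ _).measurableSet)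
    ?_ (fun x hx => Set.mem_iUnion.2 (hE x hx)) ?_ ?_).trans ?_
  · refine ⟨nodePoint A (fun _ _ => true) (k + 1), Set.mem_iUnion.2 ⟨fun _ _ => true, fun i => ?_⟩⟩
    simpa [nodePoint] using (h.A_pos (k + 1)).le
  · intro x hx y hy
    obtain ⟨σ, hy⟩ := Set.mem_iUnion.1 hy
    have h1 := h.two_mul_g_zero_le σ k.succ_pos hy i₀
    have h2 := abs_sub_apply_le_dist x y i₀
    have h3 := abs_sub_abs_le_abs_sub (y i₀) (x i₀)
    rw [abs_sub_comm] at h3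
    linarith [hF x hx, h.g_anti (Nat.zero_le k)]
  · intro x hx hxT
    refine (h.mem_cell_or_far hi hx fun σ hσ => hxT ?_).imp (fun h => Set.mem_iUnion.2 h)
      fun h y hy => ?_
    · exact Set.mem_iUnion.2 ⟨_, (tube_extendAddress σ k).symm ▸ hσ⟩
    · obtain ⟨σ, hy⟩ := Set.mem_iUnion.1 hy
      exact h σ y hy
  · refine (mul_le_mul_right hvol _).trans ?_
    rw [← ENNReal.ofReal_mul (by positivity)]
    refine ENNReal.ofReal_le_ofReal (le_of_eq ?_)
    ring

end IsTreeScale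

end Tree

end

/-! ### Hausdorff content: a uniform mass distribution -/

section

open MeasureTheory

variable {n : ℕ} {i₀ i₁ : Fin n} {s κ L : ℝ} {A g : ℕ → ℝ}

/-- The closed cube of edge length `g k` around the node of level `k` with address `σ`. -/
def core (A g : ℕ → ℝ) (σ : ℕ → Fin n → Bool) (k : ℕ) : Set (EuclideanSpace ℝ (Fin n)) :=
  {x | ∀ i, |x i - node A (fun j => σ j i) k| ≤ g k / 2}

/-- The union of the cubes `core A g σ k` of level `k`. -/
def cores (n : ℕ) (A g : ℕ → ℝ) (k : ℕ) : Set (EuclideanSpace ℝ (Fin n)) :=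
  ⋃ τ : Fin k → Fin n → Bool, core A g (extendAddress τ) k

theorem isClosed_core (σ : ℕ → Fin n → Bool) (k : ℕ) : IsClosed (core A g σ k) := by
  simp only [core, Set.ofPred_forall]
  exact isClosed_iInter fun i => isClosed_le (by fun_prop) continuous_const

theorem volume_core_inter_ball_le (σ : ℕ → Fin n → Bool) (k : ℕ) (x : EuclideanSpace ℝ (Fin n))
    (r : ℝ) : volume (core A g σ k ∩ Metric.ball x r) ≤ ENNReal.ofReal (2 * r) ^ n := by
  refine (measure_mono (Set.inter_subset_right.trans
    (ball_subset_openBox (a := fun i => x i) (b := fun _ => r) fun i => by simp))).trans_eq ?_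
  rw [volume_openBox]
  simp

theorem volume_core (σ : ℕ → Fin n → Bool) (k : ℕ) :
    volume (core A g σ k) = ENNReal.ofReal (g k) ^ n := by
  have h : core A g σ k = WithLp.ofLp ⁻¹' (Set.univ.pi fun i => Set.Icc
      (node A (fun j => σ j i) k - g k / 2) (node A (fun j => σ j i) k + g k / 2)) := by
    ext x
    simp only [core, Set.mem_ofPred_eq, Set.mem_preimage, Set.mem_univ_pi, Set.mem_Icc, abs_le]
    exact forall_congr' fun i => ⟨fun h => ⟨by linarith, by linarith⟩,
      fun h => ⟨by linarith, by linarith⟩⟩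
  rw [h, (PiLp.volume_preserving_ofLp (Fin n)).measure_preimage
    (MeasurableSet.univ_pi fun i => measurableSet_Icc).nullMeasurableSet, volume_pi_pi]
  simp only [Real.volume_Icc, add_sub_sub_cancel, add_halves, Finset.prod_const, Finset.card_univ,
    Fintype.card_fin]

namespace IsTreeScale

theorem core_subset_cell (h : IsTreeScale s κ L A g) (σ : ℕ → Fin n → Bool) (k : ℕ) :
    core A g σ k ⊆ cell A σ k := fun x hx i => by
  linarith [hx i, h.g_le k, h.g_pos k]

theorem core_subset_room (h : IsTreeScale s κ L A g) (σ : ℕ → Fin n → Bool) (k : ℕ) :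
    core A g σ k ⊆ room i₀ A g σ k := fun x hx i => by
  have h1 := hx i
  have h2 := h.g_pos k
  have h3 := h.g_le k
  dsimp only
  split_ifs <;> linarith

theorem cores_subset_treeDomain (h : IsTreeScale s κ L A g) (k : ℕ) :
    cores n A g k ⊆ treeDomain i₀ s κ A g :=
  Set.iUnion_subset fun _ => (h.core_subset_room _ k).trans (room_subset_treeDomain _ k)

theorem isCompact_cores (h : IsTreeScale s κ L A g) (i₀ : Fin n) (k : ℕ) :
    IsCompact (cores n A g k) :=
  Metric.isCompact_of_isClosed_isBounded (isClosed_iUnion_of_finite fun _ => isClosed_core _ k)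
    ((h.isBounded_treeDomain (i₀ := i₀)).subset (h.cores_subset_treeDomain k))

open Classical in
/-- The number of cubes of level `k` that meet a small ball. -/
theorem card_core_inter_ball_le (h : IsTreeScale s κ L A g) {m k : ℕ} (hmk : m ≤ k)
    (x : EuclideanSpace ℝ (Fin n)) {r : ℝ} (hr : ∀ j < m, r < g j) :
    (Finset.univ.filter fun τ : Fin k → Fin n → Bool =>
      (core A g (extendAddress τ) k ∩ Metric.ball x r).Nonempty).card ≤ (2 ^ n) ^ (k - m) := by
  have hcard : (Finset.univ : Finset (Fin (k - m) → Fin n → Bool)).card = (2 ^ n) ^ (k - m) := by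
    simp
  rw [← hcard]
  refine Finset.card_le_card_of_injOn
    (fun τ j => τ ⟨m + j, by omega⟩) (fun _ _ => Finset.mem_coe.2 (Finset.mem_univ _)) ?_
  intro τ hτ τ' hτ' heq
  obtain ⟨y, hy, hyx⟩ := (Finset.mem_filter.1 (Finset.mem_coe.1 hτ)).2
  obtain ⟨z, hz, hzx⟩ := (Finset.mem_filter.1 (Finset.mem_coe.1 hτ')).2
  funext j i
  rcases lt_or_ge (j : ℕ) m with hj | hj
  · by_contra hne
    -- Two points of the ball are less than `2 * r < 2 * g j` apart, whereas addresses that differ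
    -- at letter `j < m` force a distance of at least `4 * g j`.
    have h1 := h.sep_of_ne (m := j) (k := k) j.2
      (a := fun l => extendAddress τ l i) (b := fun l => extendAddress τ' l i)
      ⟨j, le_rfl, by simpa [extendAddress] using hne⟩
      (h.core_subset_cell _ k hy i) (h.core_subset_cell _ k hz i)
    have h2 := abs_sub_apply_le_dist y z i
    have h3 := dist_triangle_right y z x
    rw [Metric.mem_ball] at hyx hzx
    linarith [hr j hj, h.g_pos j]
  · have := congrFun (congrFun heq ⟨j - m, by omega⟩) i
    simpa [Nat.add_sub_cancel' hj] using this

/-- The uniform distribution of mass on the cubes of level `k` is `q`-dimensional. -/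
theorem sum_volume_core_inter_ball_le (h : IsTreeScale s κ L A g) {q c : ℝ} (hq : 0 < q)
    (hqn : q ≤ n) (hc : 0 < c) (hcg : ∀ k, c ≤ (2 ^ n) ^ k * g k ^ q) (k : ℕ)
    (x : EuclideanSpace ℝ (Fin n)) {r : ℝ} (hr : 0 ≤ r) :
    ∑ τ : Fin k → Fin n → Bool, volume (core A g (extendAddress τ) k ∩ Metric.ball x r) ≤
      ENNReal.ofReal ((2 ^ n) ^ k * g k ^ n * (2 ^ n / c * r ^ q)) := by
  classical
  have hgk := h.g_pos k
  have hcount : ∀ (m : ℕ) (v : ℝ), m ≤ k → 0 ≤ v → (∀ j < m, r < g j) →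
      (∀ τ : Fin k → Fin n → Bool,
        volume (core A g (extendAddress τ) k ∩ Metric.ball x r) ≤ ENNReal.ofReal v) →
      ∑ τ : Fin k → Fin n → Bool, volume (core A g (extendAddress τ) k ∩ Metric.ball x r) ≤
        ENNReal.ofReal ((2 ^ n) ^ (k - m) * v) := by
    intro m v hmk hv hrm hvol
    rw [← Finset.sum_filter_of_ne (p := fun τ : Fin k → Fin n → Bool =>
      (core A g (extendAddress τ) k ∩ Metric.ball x r).Nonempty) fun τ _ hne => by
        by_contra hemp
        rw [Set.not_nonempty_iff_eq_empty.1 hemp, measure_empty] at hne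
        exact hne rfl]
    refine (Finset.sum_le_card_nsmul _ _ _ fun τ _ => hvol τ).trans ?_
    rw [nsmul_eq_mul, ENNReal.ofReal_mul (by positivity)]
    refine mul_le_mul_left ?_ _
    refine (Nat.cast_le.2 (h.card_core_inter_ball_le hmk x hrm)).trans_eq ?_
    rw [ENNReal.ofReal_pow (by positivity), ENNReal.ofReal_pow (by positivity)]
    simp
  have h2n : (1 : ℝ) ≤ 2 ^ n := one_le_pow₀ one_le_two
  -- If some gap is at most `r`, take the first such level `m`: the cubes met share their first `m`
  -- letters and are counted with full volume. Otherwise the ball meets at most one cube, and the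
  -- volume of the ball is used.
  by_cases hex : ∃ m, m ≤ k ∧ g m ≤ r
  · set m := Nat.find hex with hm
    obtain ⟨hmk, hgr⟩ : m ≤ k ∧ g m ≤ r := Nat.find_spec hex
    refine (hcount m (g k ^ n) hmk (by positivity) (fun j hj => ?_) fun τ => ?_).trans
      (ENNReal.ofReal_le_ofReal ?_)
    · have := Nat.find_min hex hj
      by_contra! hle
      exact this ⟨by omega, hle⟩
    · rw [ENNReal.ofReal_pow hgk.le, ← volume_core (A := A) (extendAddress τ) k]
      exact measure_mono Set.inter_subset_left
    · have h1 : c ≤ (2 ^ n) ^ m * r ^ q := (hcg m).trans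
        (mul_le_mul_of_nonneg_left (Real.rpow_le_rpow (h.g_pos m).le hgr hq.le) (by positivity))
      have h2 : 1 ≤ (2 ^ n) ^ m * (2 ^ n / c * r ^ q) := by
        have : (2 ^ n) ^ m * (2 ^ n / c * r ^ q) = 2 ^ n * (((2 ^ n) ^ m * r ^ q) / c) := by ring
        rw [this]
        exact one_le_mul_of_one_le_of_one_le h2n ((one_le_div hc).2 h1)
      calc (2 ^ n) ^ (k - m) * g k ^ n
          ≤ (2 ^ n) ^ (k - m) * g k ^ n * ((2 ^ n) ^ m * (2 ^ n / c * r ^ q)) :=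
            le_mul_of_one_le_right (by positivity) h2
        _ = ((2 ^ n) ^ (k - m) * (2 ^ n) ^ m) * g k ^ n * (2 ^ n / c * r ^ q) := by ring
        _ = _ := by rw [← pow_add, Nat.sub_add_cancel hmk]
  · push Not at hex
    refine (hcount k ((2 * r) ^ n) le_rfl (by positivity) (fun j hj => hex j hj.le)
      fun τ => ?_).trans (ENNReal.ofReal_le_ofReal ?_)
    · rw [ENNReal.ofReal_pow (by positivity)]
      exact volume_core_inter_ball_le _ k x r
    · have hrn : r ^ n * g k ^ q ≤ g k ^ n * r ^ q := by
        have h0 : ∀ y : ℝ, 0 ≤ y → y ^ n = y ^ (n - q : ℝ) * y ^ q := fun y hy => by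
          rw [← Real.rpow_natCast, ← Real.rpow_add' hy]
          · ring_nf
          · rw [sub_add_cancel]; linarith
        rw [h0 r hr, h0 (g k) hgk.le]
        have := Real.rpow_le_rpow hr (hex k le_rfl).le (sub_nonneg.2 hqn)
        have h3 : 0 ≤ r ^ q * g k ^ q := by positivity
        nlinarith [mul_le_mul_of_nonneg_right this h3]
      rw [Nat.sub_self, pow_zero, one_mul, mul_pow]
      have h4 : r ^ n * c ≤ (2 ^ n) ^ k * (g k ^ n * r ^ q) := by
        calc r ^ n * c ≤ r ^ n * ((2 ^ n) ^ k * g k ^ q) :=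
              mul_le_mul_of_nonneg_left (hcg k) (by positivity)
          _ = (2 ^ n) ^ k * (r ^ n * g k ^ q) := by ring
          _ ≤ _ := mul_le_mul_of_nonneg_left hrn (by positivity)
      have h5 : (2 ^ n) ^ k * g k ^ n * (2 ^ n / c * r ^ q) =
          2 ^ n * ((2 ^ n) ^ k * (g k ^ n * r ^ q) / c) := by ring
      rw [h5]
      exact mul_le_mul_of_nonneg_left ((le_div_iff₀ hc).2 h4) (by positivity)

/-- The mass distribution principle: a covering must carry the total volume `V` of the cubes, while
a ball of radius `r` carries at most `V * (2 ^ n / c) * r ^ q`. -/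
theorem le_hausdorffContent_cores (h : IsTreeScale s κ L A g) {q c : ℝ} (hq : 0 < q)
    (hqn : q ≤ n) (hc : 0 < c) (hcg : ∀ k, c ≤ (2 ^ n) ^ k * g k ^ q) (k : ℕ) :
    ENNReal.ofReal (c / 2 ^ n) ≤ hausdorffContent q (cores n A g k) := by
  have hgk := h.g_pos k
  refine le_iInf₂ fun x r => le_iInf fun hcov => ?_
  set V : ℝ := (2 ^ n) ^ k * g k ^ n with hV
  have hVpos : 0 < V := by positivity
  have h1 : ENNReal.ofReal V ≤
      ENNReal.ofReal V * (ENNReal.ofReal (2 ^ n / c) * ∑' i, (r i : ℝ≥0∞) ^ q) := by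
    calc ENNReal.ofReal V
        = ∑ τ : Fin k → Fin n → Bool, volume (core A g (extendAddress τ) k) := by
          simp only [volume_core, Finset.sum_const, Finset.card_univ, nsmul_eq_mul]
          rw [hV, ENNReal.ofReal_mul (by positivity), ENNReal.ofReal_pow hgk.le,
            ENNReal.ofReal_pow (by positivity), ENNReal.ofReal_pow (by positivity)]
          simp
      _ ≤ ∑ τ : Fin k → Fin n → Bool, ∑' i,
            volume (core A g (extendAddress τ) k ∩ Metric.ball (x i) (r i)) := by
          refine Finset.sum_le_sum fun τ _ => ?_
          refine (measure_mono fun y hy => ?_).trans (measure_iUnion_le _)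
          rw [← Set.inter_iUnion]
          exact ⟨hy, hcov (Set.mem_iUnion.2 ⟨τ, hy⟩)⟩
      _ = ∑' i, ∑ τ : Fin k → Fin n → Bool,
            volume (core A g (extendAddress τ) k ∩ Metric.ball (x i) (r i)) :=
          (Summable.tsum_finsetSum fun _ _ => ENNReal.summable).symm
      _ ≤ ∑' i, ENNReal.ofReal V * (ENNReal.ofReal (2 ^ n / c) * (r i : ℝ≥0∞) ^ q) := by
          refine ENNReal.tsum_le_tsum fun i => ?_
          refine (h.sum_volume_core_inter_ball_le hq hqn hc hcg k (x i) (r i).coe_nonneg).trans_eq ?_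
          rw [← hV, ENNReal.ofReal_mul hVpos.le,
            ENNReal.ofReal_mul (p := 2 ^ n / c) (by positivity),
            ← ENNReal.ofReal_rpow_of_nonneg (r i).coe_nonneg hq.le, ENNReal.ofReal_coe_nnreal]
      _ = _ := by rw [ENNReal.tsum_mul_left, ENNReal.tsum_mul_left]
  have h2 : 1 ≤ ENNReal.ofReal (2 ^ n / c) * ∑' i, (r i : ℝ≥0∞) ^ q := by
    have h3 : ENNReal.ofReal V ≠ 0 := by simpa using hVpos
    rw [← mul_one (ENNReal.ofReal V), mul_assoc, one_mul] at h1
    exact (ENNReal.mul_le_mul_iff_right h3 ENNReal.ofReal_ne_top).1 h1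
  calc ENNReal.ofReal (c / 2 ^ n)
      ≤ ENNReal.ofReal (c / 2 ^ n) *
        (ENNReal.ofReal (2 ^ n / c) * ∑' i, (r i : ℝ≥0∞) ^ q) := le_mul_of_one_le_right' h2
    _ = _ := by
        rw [← mul_assoc, ← ENNReal.ofReal_mul (by positivity)]
        have : c / 2 ^ n * (2 ^ n / c) = 1 := by field_simp
        rw [this, ENNReal.ofReal_one, one_mul]

end IsTreeScale

end

/-! ### Choice of the widths and gaps -/

section

open Filter

/-- Absorbs the polynomial corrections of the scales whenever an exponent leaves a geometric margin:
`s > 1` for the corridor widths, `q < D` for the content. -/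
theorem exists_add_two_pow_mul_pow_le (N : ℕ) {x : ℝ} (hx0 : 0 < x) (hx1 : x < 1) :
    ∃ B : ℝ, 0 < B ∧ ∀ k : ℕ, ((k : ℝ) + 2) ^ N * x ^ k ≤ B := by
  have h := tendsto_pow_const_mul_const_pow_of_abs_lt_one N
    (show |x| < 1 by rwa [abs_of_pos hx0])
  obtain ⟨M, hM⟩ := h.bddAbove_range
  have hM' : ∀ k : ℕ, ((k : ℝ) + 2) ^ N * x ^ k ≤ M / x ^ 2 := fun k => by
    rw [le_div_iff₀ (by positivity), mul_assoc, ← pow_add]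
    have := hM ⟨k + 2, rfl⟩
    simpa using this
  exact ⟨M / x ^ 2, lt_of_lt_of_le (by positivity) (hM' 0), hM'⟩

section Widths

variable {l : ℝ} {M : ℕ}

/-- Geometrically decreasing widths with a polynomial correction. -/
def geomWidth (l : ℝ) (M k : ℕ) : ℝ := l ^ k / ((k : ℝ) + 1) ^ M

theorem geomWidth_pos (hl : 0 < l) (M k : ℕ) : 0 < geomWidth l M k := by
  unfold geomWidth; positivity

theorem geomWidth_le_pow (hl : 0 < l) (M k : ℕ) : geomWidth l M k ≤ l ^ k :=
  div_le_self (by positivity) (one_le_pow₀ (by linarith [Nat.cast_nonneg (α := ℝ) k]))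

theorem geomWidth_succ_le (hl : 0 < l) (M k : ℕ) :
    geomWidth l M (k + 1) ≤ l * geomWidth l M k := by
  unfold geomWidth
  rw [pow_succ', mul_div_assoc]
  gcongr
  linarith

theorem geomWidth_le_succ (hl : 0 < l) (M k : ℕ) :
    geomWidth l M k ≤ 2 ^ M / l * geomWidth l M (k + 1) := by
  unfold geomWidth
  have hk : (0 : ℝ) < (k : ℝ) + 1 := by positivity
  have h1 : ((k + 1 : ℕ) : ℝ) + 1 ≤ 2 * ((k : ℝ) + 1) := by
    push_cast; linarith [Nat.cast_nonneg (α := ℝ) k]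
  have h2 : (((k + 1 : ℕ) : ℝ) + 1) ^ M ≤ 2 ^ M * ((k : ℝ) + 1) ^ M := by
    rw [← mul_pow]; exact pow_le_pow_left₀ (by positivity) h1 M
  have h3 : 2 ^ M / l * (l ^ (k + 1) / (((k + 1 : ℕ) : ℝ) + 1) ^ M) =
      2 ^ M * l ^ k / (((k + 1 : ℕ) : ℝ) + 1) ^ M := by
    rw [pow_succ]; field_simp
  rw [h3, div_le_div_iff₀ (by positivity) (by positivity)]
  nlinarith [mul_le_mul_of_nonneg_left h2 (pow_pos hl k).le]

/-- For `s = 1` the gaps of the Cantor construction are proportional to the widths. -/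
theorem isTreeScale_one (hl : 0 < l) (hl2 : l < 1 / 2) (M : ℕ) :
    IsTreeScale 1 ((1 - 2 * l) / 2) (2 ^ M / l) (geomWidth l M)
      fun k => (1 - 2 * l) / 2 * geomWidth l M k where
  A_pos := geomWidth_pos hl M
  g_pos k := mul_pos (by linarith) (geomWidth_pos hl M k)
  g_anti := antitone_nat_of_succ_le fun k => mul_le_mul_of_nonneg_left
    ((geomWidth_succ_le hl M k).trans (by nlinarith [geomWidth_pos hl M k])) (by linarith)
  gap k := by linarith [geomWidth_succ_le hl M k]
  κ_pos := by linarith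
  width k := by rw [Real.rpow_one]
  ratio := geomWidth_le_succ hl M

/-- With `x = k + 1` this says `1 / (k + 1) ^ M - 1 / (k + 2) ^ M ≥ 1 / (k + 2) ^ (M + 1)`, which
leaves space for the gaps even when `l = 1 / 2`. -/
theorem add_two_mul_pow_le {x : ℝ} (hx : 0 ≤ x) {M : ℕ} (hM : 1 ≤ M) :
    (x + 2) * x ^ M ≤ (x + 1) ^ (M + 1) := by
  induction M, hM using Nat.le_induction with
  | base =>
    have : (x + 1) ^ (1 + 1) = (x + 2) * x ^ 1 + 1 := by ring
    linarith
  | succ M _ ih =>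
    calc (x + 2) * x ^ (M + 1) = (x + 2) * x ^ M * x := by ring
      _ ≤ (x + 1) ^ (M + 1) * (x + 1) :=
        mul_le_mul ih (by linarith) hx (by positivity)
      _ = _ := by ring

/-- For `s > 1` the gaps of the Cantor construction may be relatively small. -/
theorem exists_isTreeScale_of_one_lt {s : ℝ} (hs : 1 < s) (hl : 0 < l) (hl2 : l ≤ 1 / 2)
    (hM : 1 ≤ M) :
    ∃ κ, IsTreeScale s κ (2 ^ M / l) (geomWidth l M) fun k => l ^ k / (2 * ((k : ℝ) + 2) ^ (M + 1)) := by
  obtain ⟨B, hB, hBk⟩ := exists_add_two_pow_mul_pow_le (M + 1) (x := l ^ (s - 1)) (by positivity)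
    (Real.rpow_lt_one hl.le (by linarith) (by linarith))
  refine ⟨1 / (2 * B), geomWidth_pos hl M, fun k => by positivity,
    antitone_nat_of_succ_le fun k => ?_, fun k => ?_, by positivity, fun k => ?_,
    geomWidth_le_succ hl M⟩
  · have : l ^ (k + 1) ≤ l ^ k := pow_le_pow_of_le_one hl.le (by linarith) (Nat.le_succ k)
    gcongr
    exact Nat.le_succ k
  · have hx : (0 : ℝ) < (k : ℝ) + 1 := by positivity
    have h1 := add_two_mul_pow_le hx.le hM
    have h2 : 1 / ((k : ℝ) + 2) ^ (M + 1) ≤ 1 / ((k : ℝ) + 1) ^ M - 1 / ((k : ℝ) + 2) ^ M := by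
      have h3 : 1 / ((k : ℝ) + 2) ^ (M + 1) + 1 / ((k : ℝ) + 2) ^ M =
          ((k : ℝ) + 1 + 2) / ((k : ℝ) + 2) ^ (M + 1) := by
        rw [pow_succ]; field_simp; ring
      rw [le_sub_iff_add_le, h3, div_le_div_iff₀ (by positivity) (by positivity), one_mul]
      refine h1.trans_eq ?_
      ring
    have h4 : geomWidth l M (k + 1) ≤ l ^ k * (1 / 2) * (1 / ((k : ℝ) + 2) ^ M) := by
      unfold geomWidth
      have h5 : ((k + 1 : ℕ) : ℝ) + 1 = (k : ℝ) + 2 := by push_cast; ring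
      rw [h5, pow_succ, ← div_eq_mul_one_div]
      gcongr
    have h6 : geomWidth l M k = l ^ k * (1 / ((k : ℝ) + 1) ^ M) := by
      unfold geomWidth; rw [← div_eq_mul_one_div]
    have h7 : 2 * (l ^ k / (2 * ((k : ℝ) + 2) ^ (M + 1))) =
        l ^ k * (1 / ((k : ℝ) + 2) ^ (M + 1)) := by field_simp
    rw [h7, h6]
    nlinarith [mul_le_mul_of_nonneg_left h2 (pow_pos hl k).le]
  · have h1 : geomWidth l M k ^ s ≤ l ^ k * (l ^ (s - 1)) ^ k := by
      calc geomWidth l M k ^ s ≤ (l ^ k) ^ s :=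
            Real.rpow_le_rpow (geomWidth_pos hl M k).le (geomWidth_le_pow hl M k) (by linarith)
        _ = (l ^ s) ^ k := by
            rw [← Real.rpow_natCast, ← Real.rpow_natCast, ← Real.rpow_mul hl.le,
              ← Real.rpow_mul hl.le, mul_comm]
        _ = l ^ k * (l ^ (s - 1)) ^ k := by
            rw [← mul_pow, Real.rpow_sub_one hl.ne', mul_div_cancel₀ _ hl.ne']
    have h2 := hBk k
    calc 1 / (2 * B) * geomWidth l M k ^ s ≤ 1 / (2 * B) * (l ^ k * (l ^ (s - 1)) ^ k) :=
          mul_le_mul_of_nonneg_left h1 (by positivity)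
      _ = l ^ k * (l ^ (s - 1)) ^ k / (2 * B) := by ring
      _ ≤ _ := by
        rw [div_le_div_iff₀ (by positivity) (by positivity)]
        nlinarith [mul_le_mul_of_nonneg_left h2 (pow_pos hl k).le]

variable {g : ℕ → ℝ} {C D : ℝ} {n : ℕ}

/-- The cubes of size `g k` carry a mass distribution of any dimension `q < D`. -/
theorem exists_le_pow_mul_rpow (hl : 0 < l) (hl1 : l < 1) (hlD : l ^ D * 2 ^ n = 1) (hC : 0 < C)
    (hg : ∀ k, geomWidth l M k ≤ C * ((k : ℝ) + 2) * g k) {q : ℝ} (hq : 0 < q) (hqD : q < D) :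
    ∃ c : ℝ, 0 < c ∧ ∀ k, c ≤ (2 ^ n) ^ k * g k ^ q := by
  obtain ⟨B, hB, hBk⟩ := exists_add_two_pow_mul_pow_le (M + 1) (x := l ^ (D / q - 1))
    (by positivity) (Real.rpow_lt_one hl.le hl1 (by rw [sub_pos, one_lt_div hq]; exact hqD))
  refine ⟨((C * B) ^ q)⁻¹, by positivity, fun k => ?_⟩
  have h1 : (l ^ (D / q)) ^ k / (C * B) ≤ g k := by
    have h2 : l ^ k / ((k : ℝ) + 2) ^ M ≤ C * ((k : ℝ) + 2) * g k := by
      refine le_trans ?_ (hg k)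
      unfold geomWidth
      gcongr
      norm_num
    have h3 : l ^ k ≤ C * g k * ((k : ℝ) + 2) ^ (M + 1) := by
      rw [div_le_iff₀ (by positivity)] at h2
      refine h2.trans_eq ?_
      ring
    have hg0 : 0 ≤ C * g k := by
      by_contra! hneg
      have := mul_neg_of_neg_of_pos hneg (show 0 < ((k : ℝ) + 2) ^ (M + 1) by positivity)
      linarith [pow_pos hl k]
    have h4 : (l ^ (D / q)) ^ k = l ^ k * (l ^ (D / q - 1)) ^ k := by
      rw [← mul_pow, Real.rpow_sub_one hl.ne', mul_div_cancel₀ _ hl.ne']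
    rw [div_le_iff₀ (by positivity), h4]
    calc l ^ k * (l ^ (D / q - 1)) ^ k
        ≤ C * g k * ((k : ℝ) + 2) ^ (M + 1) * (l ^ (D / q - 1)) ^ k :=
          mul_le_mul_of_nonneg_right h3 (by positivity)
      _ = C * g k * (((k : ℝ) + 2) ^ (M + 1) * (l ^ (D / q - 1)) ^ k) := by ring
      _ ≤ C * g k * B := mul_le_mul_of_nonneg_left (hBk k) hg0
      _ = g k * (C * B) := by ring
  have h5 : ((l ^ (D / q)) ^ k) ^ q = (l ^ D) ^ k := by
    rw [← Real.rpow_natCast, ← Real.rpow_natCast, ← Real.rpow_mul hl.le, ← Real.rpow_mul hl.le,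
      ← Real.rpow_mul hl.le]
    congr 1
    field_simp
  calc ((C * B) ^ q)⁻¹ = (2 ^ n) ^ k * ((l ^ (D / q)) ^ k / (C * B)) ^ q := by
        rw [Real.div_rpow (by positivity) (by positivity), h5, ← mul_div_assoc, ← mul_pow,
          mul_comm (2 ^ n), hlD, one_pow, one_div]
    _ ≤ _ := mul_le_mul_of_nonneg_left (Real.rpow_le_rpow (by positivity) h1 hq.le) (by positivity)

/-- The energy of all corridors of one level tends to zero. -/
theorem tendsto_energy {s p : ℝ} (hn : 1 ≤ n) (hl : 0 < l) (hl1 : l < 1)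
    (hlD : l ^ D * 2 ^ n = 1) (hC : 0 < C) (hp : 0 < p) (hpM : p < M * D) (hg0 : ∀ k, 0 < g k)
    (hg : ∀ k, geomWidth l M k ≤ C * ((k : ℝ) + 2) * g k) (hD : D ≤ ((n : ℝ) - 1) * s + 1 - p) :
    Tendsto (fun k => (2 ^ n) ^ k * (geomWidth l M k ^ s) ^ (n - 1) * geomWidth l M k *
      g k ^ (-p)) atTop (𝓝 0) := by
  have hbound : ∀ k : ℕ, (2 ^ n) ^ k * (geomWidth l M k ^ s) ^ (n - 1) * geomWidth l M k *
      g k ^ (-p) ≤ (2 * C) ^ p * ((k : ℝ) + 1) ^ (-(M * D - p)) := fun k => by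
    have hA := geomWidth_pos hl M k
    have hgk := hg0 k
    have hA1 : geomWidth l M k ≤ 1 :=
      (geomWidth_le_pow hl M k).trans (pow_le_one₀ hl.le hl1.le)
    have hk : (0 : ℝ) < (k : ℝ) + 1 := by positivity
    have h1 : geomWidth l M k ≤ 2 * C * ((k : ℝ) + 1) * g k := by
      refine (hg k).trans ?_
      gcongr ?_ * _
      nlinarith [Nat.cast_nonneg (α := ℝ) k]
    have h2 : g k ^ (-p) ≤ geomWidth l M k ^ (-p) * (2 * C * ((k : ℝ) + 1)) ^ p := by
      have h3 := Real.rpow_le_rpow hA.le h1 hp.le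
      rw [Real.mul_rpow (by positivity) hgk.le] at h3
      rw [Real.rpow_neg hgk.le, Real.rpow_neg hA.le, inv_mul_eq_div, ← one_div,
        div_le_div_iff₀ (by positivity) (by positivity), one_mul]
      exact h3
    have h4 : (geomWidth l M k ^ s) ^ (n - 1) * geomWidth l M k * geomWidth l M k ^ (-p) =
        geomWidth l M k ^ (((n : ℝ) - 1) * s + 1 - p) := by
      rw [← Real.rpow_natCast, ← Real.rpow_mul hA.le, ← Real.rpow_add_one hA.ne',
        ← Real.rpow_add hA, Nat.cast_sub hn, Nat.cast_one]
      congr 1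
      ring
    have h5 : geomWidth l M k ^ (((n : ℝ) - 1) * s + 1 - p) ≤ geomWidth l M k ^ D :=
      Real.rpow_le_rpow_of_exponent_ge hA hA1 hD
    -- The normalisation `l ^ D * 2 ^ n = 1` cancels the geometric factors, so the decay comes from
    -- the polynomial correction alone.
    have h6 : (2 ^ n) ^ k * geomWidth l M k ^ D = ((k : ℝ) + 1) ^ (-(M * D)) := by
      have h7 : (l ^ k) ^ D = (l ^ D) ^ k := by
        rw [← Real.rpow_natCast, ← Real.rpow_natCast, ← Real.rpow_mul hl.le,
          ← Real.rpow_mul hl.le, mul_comm]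
      unfold geomWidth
      rw [Real.div_rpow (by positivity) (by positivity), h7, ← mul_div_assoc, ← mul_pow,
        mul_comm (2 ^ n), hlD, one_pow, ← Real.rpow_natCast, ← Real.rpow_mul hk.le,
        Real.rpow_neg hk.le, one_div]
    calc (2 ^ n) ^ k * (geomWidth l M k ^ s) ^ (n - 1) * geomWidth l M k * g k ^ (-p)
        ≤ (2 ^ n) ^ k * (geomWidth l M k ^ s) ^ (n - 1) * geomWidth l M k *
          (geomWidth l M k ^ (-p) * (2 * C * ((k : ℝ) + 1)) ^ p) :=
          mul_le_mul_of_nonneg_left h2 (by positivity)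
      _ = (2 ^ n) ^ k * ((geomWidth l M k ^ s) ^ (n - 1) * geomWidth l M k *
          geomWidth l M k ^ (-p)) * (2 * C * ((k : ℝ) + 1)) ^ p := by ring
      _ ≤ (2 ^ n) ^ k * geomWidth l M k ^ D * (2 * C * ((k : ℝ) + 1)) ^ p := by
          rw [h4]; gcongr
      _ = _ := by
          rw [h6, Real.mul_rpow (by positivity) hk.le, mul_left_comm, ← Real.rpow_add hk]
          congr 2
          ring
  refine squeeze_zero (fun k => ?_) hbound ?_
  · have := geomWidth_pos hl M k
    have := hg0 k
    positivity
  · have h1 : Tendsto (fun k : ℕ => (k : ℝ) + 1) atTop atTop :=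
      tendsto_atTop_add_const_right _ _ tendsto_natCast_atTop_atTop
    have h2 := ((tendsto_rpow_neg_atTop (show 0 < M * D - p by linarith)).comp h1).const_mul
      ((2 * C) ^ p)
    simpa using h2

end Widths

/-- The parameters of the construction. -/
theorem exists_isTreeScale {n : ℕ} (hn : 1 ≤ n) {s p D : ℝ} (hs : 1 ≤ s) (hp : 0 < p) (hD : 0 < D)
    (hDn : D ≤ n) (hsD : s = 1 → D < n) :
    ∃ (κ L : ℝ) (A g : ℕ → ℝ), IsTreeScale s κ L A g ∧
      (D ≤ ((n : ℝ) - 1) * s + 1 - p →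
        Tendsto (fun k => (2 ^ n) ^ k * (A k ^ s) ^ (n - 1) * A k * g k ^ (-p)) atTop (𝓝 0)) ∧
      ∀ q, 0 < q → q < D → ∃ c : ℝ, 0 < c ∧ ∀ k, c ≤ (2 ^ n) ^ k * g k ^ q := by
  set l : ℝ := 2 ^ (-(n : ℝ) / D) with hldef
  have hl : 0 < l := by positivity
  have hl2 : l ≤ 1 / 2 := by
    rw [hldef, one_div, ← Real.rpow_neg_one]
    refine Real.rpow_le_rpow_of_exponent_le one_le_two ?_
    rw [div_le_iff₀ hD]; linarith
  have hlD : l ^ D * 2 ^ n = 1 := by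
    rw [hldef, ← Real.rpow_mul zero_le_two, div_mul_cancel₀ _ hD.ne', ← Real.rpow_natCast,
      ← Real.rpow_add two_pos, neg_add_cancel, Real.rpow_zero]
  -- `M * D > p` compensates the factor `(k + 1) ^ p` lost in bounding `g k ^ (-p)` by `A k ^ (-p)`.
  obtain ⟨M, hM⟩ := exists_nat_gt (p / D)
  have hM1 : 1 ≤ M := by
    have : (0 : ℝ) < M := lt_trans (by positivity) hM
    exact_mod_cast this
  rw [div_lt_iff₀ hD] at hM
  rcases hs.eq_or_lt with rfl | hs
  · have hlt : l < 1 / 2 := by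
      rw [hldef, one_div, ← Real.rpow_neg_one]
      refine Real.rpow_lt_rpow_of_exponent_lt one_lt_two ?_
      rw [div_lt_iff₀ hD]; linarith [hsD rfl]
    have h := isTreeScale_one hl hlt M
    have hC : 0 < 2 / (1 - 2 * l) := div_pos two_pos (by linarith)
    have hg : ∀ k : ℕ, geomWidth l M k ≤
        2 / (1 - 2 * l) * ((k : ℝ) + 2) * ((1 - 2 * l) / 2 * geomWidth l M k) := fun k => by
      have h0 : 1 - 2 * l ≠ 0 := by linarith
      have h1 : 2 / (1 - 2 * l) * ((k : ℝ) + 2) * ((1 - 2 * l) / 2 * geomWidth l M k) =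
          ((k : ℝ) + 2) * geomWidth l M k := by field_simp
      rw [h1]
      nlinarith [geomWidth_pos hl M k, Nat.cast_nonneg (α := ℝ) k]
    exact ⟨_, _, _, _, h, tendsto_energy hn hl (by linarith) hlD hC hp hM h.g_pos hg,
      fun q hq hqD => exists_le_pow_mul_rpow hl (by linarith) hlD hC hg hq hqD⟩
  · obtain ⟨κ, h⟩ := exists_isTreeScale_of_one_lt hs hl hl2 hM1
    have hg : ∀ k : ℕ, geomWidth l M k ≤
        2 * 2 ^ M * ((k : ℝ) + 2) * (l ^ k / (2 * ((k : ℝ) + 2) ^ (M + 1))) := fun k => by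
      have h1 : 2 * 2 ^ M * ((k : ℝ) + 2) * (l ^ k / (2 * ((k : ℝ) + 2) ^ (M + 1))) =
          2 ^ M * l ^ k / ((k : ℝ) + 2) ^ M := by rw [pow_succ]; field_simp
      have h2 : ((k : ℝ) + 2) ^ M ≤ 2 ^ M * ((k : ℝ) + 1) ^ M := by
        rw [← mul_pow]
        exact pow_le_pow_left₀ (by positivity) (by linarith [Nat.cast_nonneg (α := ℝ) k]) M
      rw [h1, geomWidth, div_le_div_iff₀ (by positivity) (by positivity)]
      nlinarith [mul_le_mul_of_nonneg_left h2 (pow_pos hl k).le]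
    exact ⟨_, _, _, _, h, tendsto_energy hn hl (by linarith) hlD (by positivity) hp hM h.g_pos hg,
      fun q hq hqD => exists_le_pow_mul_rpow hl (by linarith) hlD (by positivity) hg hq hqD⟩

/-- A Whitney cube that contains the origin is contained in the slab `|x i₀| ≤ g 0`. -/
theorem IsTreeScale.whitney_cube_subset {n : ℕ} {i₀ i₁ : Fin n} {s κ L : ℝ} {A g : ℕ → ℝ}
    (h : IsTreeScale s κ L A g) (hi : i₁ ≠ i₀) {W : Set (Set (EuclideanSpace ℝ (Fin n)))}
    (hW : IsWhitneyDecomposition (treeDomain i₀ s κ A g) W) {Q : Set (EuclideanSpace ℝ (Fin n))}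
    (hQ : Q ∈ W) (h0 : 0 ∈ Q) {x : EuclideanSpace ℝ (Fin n)} (hx : x ∈ Q) (i : Fin n) :
    |x i| ≤ g 0 := by
  have hb : Bornology.IsBounded Q := by
    obtain ⟨a, l, hl, rfl⟩ := hW.isCube Q hQ
    refine (Metric.isBounded_closedBall (x := a) (r := n * l)).subset fun y hy => ?_
    refine dist_le_card_mul hl.le fun i => ?_
    have := hy i
    rw [abs_le]
    constructor <;> linarith [this.1, this.2]
  -- The cube contains the origin, which is at distance `g 0` from a boundary point; the Whitney
  -- condition then bounds the diameter by `g 0`.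
  have h1 : setDist Q (frontier (treeDomain i₀ s κ A g)) ≤ g 0 := by
    refine csInf_le ⟨0, ?_⟩ ⟨0, h0, _, h.single_mem_frontier hi, ?_⟩
    · rintro _ ⟨y, -, z, -, rfl⟩
      exact dist_nonneg
    · simp [abs_of_pos (h.g_pos 0)]
  have h2 := Metric.dist_le_diam_of_mem hb hx h0
  have h3 := abs_sub_apply_le_dist x 0 i
  rw [PiLp.zero_apply, sub_zero] at h3
  linarith [hW.diam_le_dist Q hQ]

end

end SJohn

end

/-! ### Assembly of the theorem -/

theorem theorem1p3 (n : ℕ) (hn : 2 ≤ n) (p s : ℝ) (hp : 1 ≤ p) (hpn : p ≤ n) (hs : 1 ≤ s) :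
    ∃ (Ω : Set (EuclideanSpace ℝ (Fin n))) (x₀ : EuclideanSpace ℝ (Fin n)),
      SJohn.IsSJohnDomain s Ω x₀ ∧
      ∃ E : ℕ → Set (EuclideanSpace ℝ (Fin n)),
        (∀ j, IsCompact (E j) ∧ E j ⊆ Ω) ∧
        ∀ W : Set (Set (EuclideanSpace ℝ (Fin n))), SJohn.IsWhitneyDecomposition Ω W →
          ∀ Q₀ ∈ W, x₀ ∈ Q₀ →
            (∀ j, Disjoint (E j) Q₀) ∧
            ∀ q : ℝ, 0 < q → q < min (((n : ℝ) - 1) * s + 1 - p) n →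
              (∃ c : ℝ, 0 < c ∧ ∀ j, ENNReal.ofReal c ≤ SJohn.hausdorffContent q (E j)) ∧
              Filter.Tendsto (fun j => SJohn.capacity p (E j) Q₀ Ω) Filter.atTop (𝓝 0) := by
  have hp0 : 0 < p := by linarith
  have hs0 : 0 ≤ s := by linarith
  have hn' : (2 : ℝ) ≤ n := by exact_mod_cast hn
  obtain ⟨D, hD0, hDn, hsD, hDmin⟩ : ∃ D : ℝ, 0 < D ∧ D ≤ n ∧ (s = 1 → D < n) ∧
      (0 < min (((n : ℝ) - 1) * s + 1 - p) n → D = min (((n : ℝ) - 1) * s + 1 - p) n) := by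
    by_cases hpos : 0 < min (((n : ℝ) - 1) * s + 1 - p) n
    · refine ⟨_, hpos, min_le_right _ _, fun h1 => min_lt_of_left_lt ?_, fun _ => rfl⟩
      rw [h1]; linarith
    -- If the minimum is not positive, no `q` is admissible; the domain must still exist, and `D =
    -- 1` is an arbitrary choice.
    · exact ⟨1, one_pos, by linarith, fun _ => by linarith, fun h => absurd h hpos⟩
  obtain ⟨κ, L, A, g, h, henergy, hcontent⟩ :=
    SJohn.exists_isTreeScale (by omega : 1 ≤ n) hs hp0 hD0 hDn hsD
  set i₀ : Fin n := ⟨0, by omega⟩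
  have hi : (⟨1, by omega⟩ : Fin n) ≠ i₀ := by simp [i₀]
  have hcell : ∀ j, ∀ x ∈ SJohn.cores n A g (j + 1), ∃ σ, x ∈ SJohn.cell A σ (j + 1) :=
    fun j x hx => by
      obtain ⟨τ, hx⟩ := Set.mem_iUnion.1 hx
      exact ⟨_, h.core_subset_cell _ _ hx⟩
  refine ⟨SJohn.treeDomain i₀ s κ A g, 0, h.isSJohnDomain_treeDomain hs hi,
    -- The level-zero cube surrounds the John centre, so the sequence starts at level one;
    -- `capacity_le` at level `j` concerns the cells of level `j + 1`.
    fun j => SJohn.cores n A g (j + 1),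
    fun j => ⟨h.isCompact_cores i₀ _, h.cores_subset_treeDomain _⟩, fun W hW Q hQ h0 => ⟨?_, ?_⟩⟩
  · refine fun j => Set.disjoint_left.2 fun x hx hxQ => ?_
    obtain ⟨σ, hσ⟩ := hcell j x hx
    linarith [h.two_mul_g_zero_le σ j.succ_pos hσ i₀, h.whitney_cube_subset hi hW hQ h0 hxQ i₀,
      h.g_pos 0]
  · intro q hq hqmin
    have hDeq := hDmin (hq.trans hqmin)
    rw [← hDeq] at hqmin
    constructor
    · obtain ⟨c, hc, hcg⟩ := hcontent q hq hqmin
      exact ⟨c / 2 ^ n, by positivity, fun j =>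
        h.le_hausdorffContent_cores hq (by linarith) hc hcg (j + 1)⟩
    · have hlim := ENNReal.tendsto_ofReal ((henergy (hDeq.trans_le (min_le_left _ _))).const_mul
        (2 ^ n * ((2 * κ) ^ (n - 1) * 3)))
      rw [mul_zero, ENNReal.ofReal_zero] at hlim
      exact tendsto_of_tendsto_of_tendsto_of_le_of_le tendsto_const_nhds hlim
        (fun _ => zero_le) fun j => h.capacity_le hs0 hi hp0 (hcell j)
          fun x hx => h.whitney_cube_subset hi hW hQ h0 hx i₀
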